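/- Let $A$ be a Noetherian commutative ring, $F$ a commutative $A$-algebra of finite type, $n\geq 1$ an integer. Let $\Gamma_A F$ be the divided power algebra of the $A$-module $F$, with (external) product $*$, and let $\Gamma^n_A F$ be its degree $n$ component, regarded as a commutative $A$-algebra under the internal product, for which $\gamma^n\colon F\to\Gamma^n_AF$ is the universal norm of degree $n$ (so $\gamma^n(x)\gamma^n(y)=\gamma^n(xy)$ and $\gamma^n(1)=1$). For $x_1,\dots,x_n,y_1,\dots,y_n\in F$ put $$\delta(x,y)=\sum_{\sigma\in\mathfrak S_n}(-1)^{|\sigma|}\,\gamma^1(x_1y_{\sigma(1)})*\cdots*\gamma^1(x_ny_{\sigma(n)})\in\Gamma^n_AF,$$ and for an $A$-submodule $V\subseteq F$ let the ideal of norms $I_V\subseteq\Gamma^n_AF$ be the ideal generated by all $\delta(x,y)$ with all $x_i,y_j\in V$. The submodule $V$ is called $n$-sufficiently big if for every $A$-algebra $B$ and every quotient algebra $E$ of $F\otimes_AB$ that is locally free of rank $n$ as a $B$-module, the composite $V\otimes_AB\to F\otimes_AB\to E$ is surjective. Let $V\subseteq F$ be an $n$-sufficiently big $A$-submodule. Then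 the inclusion of Rees algebras $\iota\colon\bigoplus_{m\ge0}I_V^m\to\bigoplus_{m\ge0}I_F^m$ induces a well-defined morphism $$\varphi\colon \operatorname{Proj}\Big(\bigoplus_{m\ge0}I_F^m\Big)\longrightarrow \operatorname{Bl}_{I_V}(\Gamma^n_AF)=\operatorname{Proj}\Big(\bigoplus_{m\ge0}I_V^m\Big);$$ that is, for every point $\mathfrak p$ of the source some homogeneous element $a$ of positive degree of $\bigoplus_m I_V^m$ has $\iota(a)\notin\mathfrak p$, and there is a unique morphism $\varphi$ that restricts, for every homogeneous $a\in\bigoplus_m I_V^m$ of positive degree, to the morphism $D_+(\iota(a))\to D_+(a)$ given by $\iota$ on the degree zero parts of the localizations at $a$ and $\iota(a)$. Moreover, $\varphi$ is a finite morphism. (The source is the blow-up of $\operatorname{Spec}\Gamma^n_AF$ along $I_F$; it is called the good component, since it is identified with the schematic closure of the locus of étale families in the Hilbert scheme of $n$ points of $\operatorname{Spec}F$ over $\operatorname{Spec}A$.) -/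

import Mathlib

universe u

namespace NormBlowup

section
open DividedPowerAlgebra (dp)
open Finset

variable {A F : Type u} [CommRing A] [CommRing F] [Algebra A F]

/-- The external product `γ^{a₁}(x₁) * ⋯ * γ^{aₖ}(xₖ)` in the divided power algebra of `F` over `A`.
The multiplication of the ring `DividedPowerAlgebra A F` is the external product `*`. -/
noncomputable def monom (A : Type u) {F : Type u} [CommRing A] [CommRing F] [Algebra A F] {ι : Type} [Fintype ι] (x : ι → F) (a : ι → ℕ) :
    DividedPowerAlgebra A F :=
  ∏ i, dp A (a i) (x i)

/-- The coefficients `eₘ` of the power series satisfy `eₘ eₙ = (m+n choose m) eₘ₊ₙ`. -/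
def IsDP {R : Type u} [CommRing R] (e : PowerSeries R) : Prop :=
  ∀ m n : ℕ, PowerSeries.coeff m e * PowerSeries.coeff n e =
    (m + n).choose m • PowerSeries.coeff (m + n) e

theorem IsDP.one {R : Type u} [CommRing R] : IsDP (1 : PowerSeries R) := by
  intro m n
  simp only [PowerSeries.coeff_one]
  rcases Nat.eq_zero_or_pos m with rfl | hm
  · simp
  · simp [hm.ne']

theorem IsDP.mul {R : Type u} [CommRing R] {e f : PowerSeries R} (he : IsDP e) (hf : IsDP f) :
    IsDP (e * f) := by
  intro m n
  simp only [PowerSeries.coeff_mul, Finset.sum_mul_sum, ← Finset.sum_product']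
  have h1 : ∀ z ∈ antidiagonal m ×ˢ antidiagonal n,
      PowerSeries.coeff z.1.1 e * PowerSeries.coeff z.1.2 f *
        (PowerSeries.coeff z.2.1 e * PowerSeries.coeff z.2.2 f) =
      ((z.1.1 + z.2.1).choose z.1.1 * (z.1.2 + z.2.2).choose z.1.2) •
        (PowerSeries.coeff (z.1.1 + z.2.1) e * PowerSeries.coeff (z.1.2 + z.2.2) f) := by
    intro z _
    rw [mul_mul_mul_comm, he, hf, smul_mul_smul_comm]
  rw [Finset.sum_congr rfl h1, Finset.smul_sum]
  have h2 : ∀ p ∈ antidiagonal (m + n),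
      (m + n).choose m • (PowerSeries.coeff p.1 e * PowerSeries.coeff p.2 f) =
      ∑ ij ∈ antidiagonal m, (p.1.choose ij.1 * p.2.choose ij.2) •
        (PowerSeries.coeff p.1 e * PowerSeries.coeff p.2 f) := by
    intro p hp
    rw [← Finset.sum_smul, ← Nat.add_choose_eq, HasAntidiagonal.mem_antidiagonal.mp hp]
  rw [Finset.sum_congr rfl h2, ← Finset.sum_product']
  refine Finset.sum_bij_ne_zero
    (fun z _ _ => ((z.1.1 + z.2.1, z.1.2 + z.2.2), z.1)) ?_ ?_ ?_ ?_
  · rintro ⟨⟨i, j⟩, ⟨k, l⟩⟩ h _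
    simp only [mem_product, HasAntidiagonal.mem_antidiagonal] at h ⊢
    omega
  · rintro ⟨⟨i, j⟩, ⟨k, l⟩⟩ h _ ⟨⟨i', j'⟩, ⟨k', l'⟩⟩ h' _ heq
    simp only [Prod.mk.injEq] at heq ⊢
    omega
  · rintro ⟨⟨p, q⟩, ⟨i, j⟩⟩ h hne
    simp only [mem_product, HasAntidiagonal.mem_antidiagonal] at h
    have hip : i ≤ p := by
      by_contra hlt
      exact hne (by simp [Nat.choose_eq_zero_of_lt (not_le.mp hlt)])
    have hjq : j ≤ q := by
      by_contra hlt
      exact hne (by simp [Nat.choose_eq_zero_of_lt (not_le.mp hlt)])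
    refine ⟨((i, j), (p - i, q - j)), ?_, ?_, ?_⟩
    · simp only [mem_product, HasAntidiagonal.mem_antidiagonal]; omega
    · simpa [Nat.add_sub_cancel' hip, Nat.add_sub_cancel' hjq] using hne
    · simp [Nat.add_sub_cancel' hip, Nat.add_sub_cancel' hjq]
  · intro z _ _
    rfl

theorem IsDP.prod {R : Type u} [CommRing R] {κ : Type} [Fintype κ] {e : κ → PowerSeries R}
    (he : ∀ j, IsDP (e j)) : IsDP (∏ j, e j) :=
  Finset.prod_induction _ IsDP (fun _ _ => IsDP.mul) IsDP.one fun j _ => he j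

section Psi
variable {κ : Type} (y : κ → F)

/-- The series `∑ₙ γⁿ(x yⱼ) Tⱼⁿ Uⁿ`, with `U` the variable of the power series. -/
noncomputable def ser (j : κ) (x : F) : PowerSeries (MvPolynomial κ (DividedPowerAlgebra A F)) :=
  PowerSeries.mk fun n => MvPolynomial.monomial (Finsupp.single j n) (dp A n (x * y j))

theorem ser_add (j : κ) (x x' : F) : ser (A := A) y j (x + x') = ser y j x * ser y j x' := by
  ext1 n
  simp only [ser, PowerSeries.coeff_mul, PowerSeries.coeff_mk, MvPolynomial.monomial_mul, add_mul,
    DividedPowerAlgebra.dp_add, map_sum]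
  refine Finset.sum_congr rfl fun p hp => ?_
  rw [← Finsupp.single_add, HasAntidiagonal.mem_antidiagonal.mp hp]

theorem ser_smul (j : κ) (r : A) (x : F) : ser (A := A) y j (r • x) =
    PowerSeries.rescale (algebraMap A _ r) (ser y j x) := by
  ext1 n
  simp only [ser, PowerSeries.coeff_rescale, PowerSeries.coeff_mk, smul_mul_assoc,
    DividedPowerAlgebra.dp_smul]
  rw [← map_pow, ← Algebra.smul_def, MvPolynomial.smul_monomial]

theorem ser_isDP (j : κ) (x : F) : IsDP (ser (A := A) y j x) := by
  intro m n
  simp only [ser, PowerSeries.coeff_mk, MvPolynomial.monomial_mul, DividedPowerAlgebra.dp_mul,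
    ← Finsupp.single_add]
  rw [MvPolynomial.smul_monomial]

theorem ser_zero (j : κ) (x : F) : PowerSeries.constantCoeff (ser (A := A) y j x) = 1 := by
  rw [← PowerSeries.coeff_zero_eq_constantCoeff_apply]
  simp [ser, DividedPowerAlgebra.dp_zero]

/-- The algebra homomorphism sending `γⁿ(x)` to `∑_{|l| = n} ∏ⱼ γ^{lⱼ}(x yⱼ) Tⱼ^{lⱼ}`, that is, to the
expansion of `γⁿ(x ∑ⱼ yⱼ Tⱼ)`. -/
noncomputable def psi [Fintype κ] : DividedPowerAlgebra A F →ₐ[A] MvPolynomial κ (DividedPowerAlgebra A F) :=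
  DividedPowerAlgebra.lift' (f := fun p => PowerSeries.coeff p.1 (∏ j, ser (A := A) y j p.2))
    (by
      intro x
      simp [map_prod, ser_zero])
    (by
      intro n r x
      simp only [ser_smul, ← map_prod, PowerSeries.coeff_rescale]
      rw [← map_pow, ← Algebra.smul_def])
    (by
      intro n p x
      exact IsDP.prod (fun j => ser_isDP y j x) n p)
    (by
      intro n x x'
      simp only [ser_add, Finset.prod_mul_distrib, PowerSeries.coeff_mul])


theorem prod_monomial {R : Type u} [CommRing R] {ι : Type} [Fintype ι] (d : ι → κ →₀ ℕ)
    (c : ι → R) : ∏ i, MvPolynomial.monomial (d i) (c i) =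
      MvPolynomial.monomial (∑ i, d i) (∏ i, c i) := by
  classical
  induction (univ : Finset ι) using Finset.induction_on with
  | empty => simp
  | insert i s hi ih => rw [prod_insert hi, prod_insert hi, sum_insert hi, ih,
      MvPolynomial.monomial_mul]

variable [Fintype κ]

theorem psi_dp [DecidableEq κ] (n : ℕ) (x : F) : psi (A := A) y (dp A n x) =
    ∑ l ∈ finsuppAntidiag univ n, MvPolynomial.monomial l (∏ j, dp A (l j) (x * y j)) := by
  rw [psi, DividedPowerAlgebra.lift'_apply_dp, PowerSeries.coeff_prod]
  refine Finset.sum_congr rfl fun l _ => ?_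
  simp only [ser, PowerSeries.coeff_mk]
  rw [prod_monomial, Finsupp.univ_sum_single]

end Psi

variable {ι κ μ : Type} [Fintype ι] [Fintype κ] [Fintype μ]

/-- The matrices of natural numbers with row sums `a` and column sums `b`. -/
noncomputable def mats (a : ι → ℕ) (b : κ → ℕ) : Finset (ι × κ → ℕ) := by
  classical
  exact (Fintype.piFinset fun p : ι × κ => range (a p.1 + 1)).filter fun c =>
    (∀ i, ∑ j, c (i, j) = a i) ∧ ∀ j, ∑ i, c (i, j) = b j

theorem mem_mats {a : ι → ℕ} {b : κ → ℕ} {c : ι × κ → ℕ} :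
    c ∈ mats a b ↔ (∀ i, ∑ j, c (i, j) = a i) ∧ ∀ j, ∑ i, c (i, j) = b j := by
  classical
  simp only [mats, mem_filter, Fintype.mem_piFinset, mem_range, and_iff_right_iff_imp]
  rintro ⟨h, -⟩ ⟨i, j⟩
  rw [Nat.lt_succ_iff, ← h i]
  exact single_le_sum (f := fun j => c (i, j)) (fun _ _ => Nat.zero_le _) (mem_univ j)

theorem coeff_psi (x : ι → F) (a : ι → ℕ) (y : κ → F) (b : κ → ℕ) :
    MvPolynomial.coeff (Finsupp.equivFunOnFinite.symm b) (psi y (monom A x a)) =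
      ∑ c ∈ mats a b, monom A (fun p : ι × κ => x p.1 * y p.2) c := by
  classical
  simp only [monom, map_prod, psi_dp, Finset.prod_univ_sum, prod_monomial, MvPolynomial.coeff_sum,
    MvPolynomial.coeff_monomial, ← Finset.sum_filter]
  refine Finset.sum_nbij' (fun c p => c p.1 p.2)
    (fun c i => Finsupp.equivFunOnFinite.symm fun j => c (i, j)) ?_ ?_ ?_ ?_ ?_
  · intro c hc
    simp only [mem_filter, Fintype.mem_piFinset, mem_finsuppAntidiag] at hc
    refine mem_mats.mpr ⟨fun i => (hc.1 i).1, fun j => ?_⟩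
    have := DFunLike.congr_fun hc.2 j
    simpa [Finsupp.finsetSum_apply] using this
  · intro c hc
    rw [mem_mats] at hc
    simp only [mem_filter, Fintype.mem_piFinset, mem_finsuppAntidiag]
    refine ⟨fun i => ⟨by simpa using hc.1 i, by simp⟩, ?_⟩
    ext j
    simpa [Finsupp.finsetSum_apply] using hc.2 j
  · intro c _
    ext i j
    simp
  · intro c _
    ext p
    simp
  · intro c _
    rw [← Finset.univ_product_univ, Finset.prod_product]

theorem monom_comp (e : ι ≃ κ) (x : κ → F) (a : κ → ℕ) :
    monom A (fun i => x (e i)) (fun i => a (e i)) = monom A x a :=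
  Fintype.prod_equiv e _ _ fun _ => rfl

theorem sum_mats_comm (x : ι → F) (a : ι → ℕ) (y : κ → F) (b : κ → ℕ) :
    ∑ c ∈ mats a b, monom A (fun p : ι × κ => x p.1 * y p.2) c =
      ∑ c ∈ mats b a, monom A (fun p : κ × ι => y p.1 * x p.2) c := by
  refine Finset.sum_nbij' (fun c p => c p.swap) (fun c p => c p.swap) ?_ ?_ ?_ ?_ ?_
  · intro c hc
    rw [mem_mats] at hc ⊢
    exact ⟨hc.2, hc.1⟩
  · intro c hc
    rw [mem_mats] at hc ⊢
    exact ⟨hc.2, hc.1⟩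
  · intro c _
    rfl
  · intro c _
    rfl
  · intro c _
    rw [← monom_comp (Equiv.prodComm κ ι)]
    simp [mul_comm]

theorem sum_mats_comp {κ' : Type} [Fintype κ'] (e : κ' ≃ κ) (x : ι → F) (a : ι → ℕ)
    (y : κ → F) (b : κ → ℕ) :
    ∑ c ∈ mats a (fun j => b (e j)), monom A (fun p : ι × κ' => x p.1 * y (e p.2)) c =
      ∑ c ∈ mats a b, monom A (fun p : ι × κ => x p.1 * y p.2) c := by
  refine Finset.sum_nbij' (fun c p => c (p.1, e.symm p.2)) (fun c p => c (p.1, e p.2))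
    ?_ ?_ ?_ ?_ ?_
  · intro c hc
    rw [mem_mats] at hc ⊢
    refine ⟨fun i => ?_, fun j => ?_⟩
    · rw [← hc.1 i]
      exact Fintype.sum_equiv e.symm _ _ fun _ => rfl
    · simpa using hc.2 (e.symm j)
  · intro c hc
    rw [mem_mats] at hc ⊢
    refine ⟨fun i => ?_, fun j => hc.2 (e j)⟩
    rw [← hc.1 i]
    exact Fintype.sum_equiv e _ _ fun _ => rfl
  · intro c _
    ext p
    simp
  · intro c _
    ext p
    simp
  · intro c _
    rw [← monom_comp ((Equiv.refl ι).prodCongr e)]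
    simp

/-- Index set for the products `γ^{a₁}(x₁) * ⋯ * γ^{aₖ}(xₖ)`. -/
abbrev Idx (F : Type u) : Type u := Σ k : ℕ, (Fin k → F) × (Fin k → ℕ)

variable (A F) in
/-- The surjection from the free module on all products `γ^{a₁}(x₁) * ⋯ * γ^{aₖ}(xₖ)`. -/
noncomputable def total : (Idx F →₀ A) →ₗ[A] DividedPowerAlgebra A F :=
  Finsupp.linearCombination A fun j => monom A j.2.1 j.2.2

theorem total_surjective : Function.Surjective (total A F) := by
  rw [← LinearMap.range_eq_top, total, Finsupp.range_linearCombination, eq_top_iff]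
  set S : Submodule A (DividedPowerAlgebra A F) :=
    Submodule.span A (Set.range fun j : Idx F => monom A j.2.1 j.2.2) with hS
  have hmul : ∀ (n : ℕ) (m : F), ∀ z ∈ S, z * dp A n m ∈ S := by
    intro n m z hz
    induction hz using Submodule.span_induction with
    | mem z hz =>
      obtain ⟨⟨k, x, a⟩, rfl⟩ := hz
      refine Submodule.subset_span ⟨⟨k + 1, Fin.snoc x m, Fin.snoc a n⟩, ?_⟩
      simp [monom, Fin.prod_univ_castSucc]
    | zero => simp
    | add z w _ _ hz hw => rw [add_mul]; exact S.add_mem hz hw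
    | smul r z _ hz => rw [smul_mul_assoc]; exact S.smul_mem r hz
  intro z _
  induction z using DividedPowerAlgebra.induction_on with
  | C r =>
    rw [Algebra.algebraMap_eq_smul_one]
    exact S.smul_mem r (Submodule.subset_span ⟨⟨0, Fin.elim0, Fin.elim0⟩, by simp [monom]⟩)
  | add z w hz hw => exact S.add_mem (hz trivial) (hw trivial)
  | dp z n m hz => exact hmul n m z (hz trivial)

theorem monom_induction {P : DividedPowerAlgebra A F → Prop} (zero : P 0)
    (add : ∀ z w, P z → P w → P (z + w)) (smul : ∀ (r : A) z, P z → P (r • z))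
    (mon : ∀ (k : ℕ) (x : Fin k → F) (a : Fin k → ℕ), P (monom A x a))
    (z : DividedPowerAlgebra A F) : P z := by
  obtain ⟨v, rfl⟩ := total_surjective z
  induction v using Finsupp.induction_linear with
  | zero => simpa using zero
  | add v w hv hw => rw [map_add]; exact add _ _ hv hw
  | single j r => simpa [total] using smul r _ (mon _ j.2.1 j.2.2)

theorem hom_ext {N : Type u} [AddCommGroup N] [Module A N] {f g : DividedPowerAlgebra A F →ₗ[A] N}
    (h : ∀ (k : ℕ) (x : Fin k → F) (a : Fin k → ℕ), f (monom A x a) = g (monom A x a)) :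
    f = g := by
  have : f ∘ₗ total A F = g ∘ₗ total A F := by
    ext ⟨k, x, a⟩
    simpa [total] using h k x a
  ext z
  obtain ⟨v, rfl⟩ := total_surjective z
  exact LinearMap.congr_fun this v

variable (A F) in
/-- The internal product, with the second argument still a formal combination of products. -/
noncomputable def pairing : (Idx F →₀ A) →ₗ[A] DividedPowerAlgebra A F →ₗ[A] DividedPowerAlgebra A F :=
  Finsupp.linearCombination A fun j =>
    (MvPolynomial.lcoeff (DividedPowerAlgebra A F)
      (Finsupp.equivFunOnFinite.symm j.2.2)).restrictScalars A ∘ₗ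
      (psi (A := A) j.2.1).toLinearMap

theorem pairing_monom (v : Idx F →₀ A) (x : ι → F) (a : ι → ℕ) :
    pairing A F v (monom A x a) =
      MvPolynomial.coeff (Finsupp.equivFunOnFinite.symm a) (psi x (total A F v)) := by
  induction v using Finsupp.induction_linear with
  | zero => simp
  | add v w hv hw => simp [hv, hw]
  | single j r =>
    have := coeff_psi (A := A) x a j.2.1 j.2.2
    rw [sum_mats_comm, ← coeff_psi] at this
    simp [pairing, total, this]

theorem pairing_congr {v w : Idx F →₀ A} (h : total A F v = total A F w) :
    pairing A F v = pairing A F w := by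
  refine hom_ext fun k x a => ?_
  rw [pairing_monom, pairing_monom, h]

variable (A F) in
/-- The internal product: the bilinear map with `γⁿ(x) · γⁿ(y) = γⁿ(x y)`, and more generally
`(∏ᵢ γ^{aᵢ}(xᵢ)) · (∏ⱼ γ^{bⱼ}(yⱼ)) = ∑_c ∏ᵢⱼ γ^{cᵢⱼ}(xᵢ yⱼ)`, where `c` runs over the matrices with row
sums `a` and column sums `b` (see `imul_monom`). Components of different degree multiply to zero. -/
noncomputable def imul :
    DividedPowerAlgebra A F →ₗ[A] DividedPowerAlgebra A F →ₗ[A] DividedPowerAlgebra A F :=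
  LinearMap.mk₂ A
    (fun z w => pairing A F (Function.surjInv (total_surjective (A := A) (F := F)) w) z)
    (fun z z' w => map_add _ _ _)
    (fun r z w => map_smul _ _ _)
    (fun z w w' => by
      rw [← LinearMap.add_apply, ← map_add]
      congr 1
      exact pairing_congr (by simp only [map_add, Function.surjInv_eq]))
    (fun r z w => by
      rw [← LinearMap.smul_apply, ← map_smul]
      congr 1
      exact pairing_congr (by simp only [map_smul, Function.surjInv_eq]))

theorem imul_monom (x : ι → F) (a : ι → ℕ) (y : κ → F) (b : κ → ℕ) :
    imul A F (monom A x a) (monom A y b) =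
      ∑ c ∈ mats a b, monom A (fun p : ι × κ => x p.1 * y p.2) c := by
  have h : ∀ v w, imul A F w (total A F v) = pairing A F v w := by
    intro v w
    rw [imul, LinearMap.mk₂_apply]
    congr 1
    exact pairing_congr (Function.surjInv_eq _ _)
  let e := (Fintype.equivFin κ).symm
  rw [← sum_mats_comp e, ← coeff_psi x a (fun j => y (e j)) (fun j => b (e j)),
    ← monom_comp e y b]
  have := h (Finsupp.single ⟨_, fun j => y (e j), fun j => b (e j)⟩ 1) (monom A x a)
  simpa [total, pairing] using this

theorem imul_comm (z w : DividedPowerAlgebra A F) : imul A F z w = imul A F w z := by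
  suffices h : imul A F = (imul A F).flip from LinearMap.congr_fun₂ h z w
  refine hom_ext fun k x a => hom_ext fun l y b => ?_
  rw [LinearMap.flip_apply, imul_monom, imul_monom, sum_mats_comm]

theorem imul_assoc_monom (x : ι → F) (a : ι → ℕ) (y : κ → F) (b : κ → ℕ) (w : μ → F) (d : μ → ℕ) :
    imul A F (imul A F (monom A x a) (monom A y b)) (monom A w d) =
      imul A F (monom A x a) (imul A F (monom A y b) (monom A w d)) := by
  classical
  simp only [imul_monom, map_sum, LinearMap.sum_apply]
  rw [Finset.sum_sigma', Finset.sum_sigma']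
  refine Finset.sum_nbij'
    (fun s => ⟨fun q => ∑ i, s.2 ((i, q.1), q.2), fun p => s.2 ((p.1, p.2.1), p.2.2)⟩)
    (fun s => ⟨fun q => ∑ k, s.2 (q.1, (q.2, k)), fun p => s.2 (p.1.1, (p.1.2, p.2))⟩)
    ?_ ?_ ?_ ?_ ?_
  · rintro ⟨c, e⟩ h
    simp only [mem_sigma, mem_mats] at h ⊢
    obtain ⟨⟨h1, h2⟩, h3, h4⟩ := h
    refine ⟨⟨fun j => ?_, fun k => ?_⟩, fun i => ?_, fun _ => trivial⟩
    · rw [Finset.sum_comm]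
      simp only [h3, h2]
    · rw [← h4 k, Fintype.sum_prod_type, Finset.sum_comm]
    · rw [Fintype.sum_prod_type]
      simp only [h3, h1]
  · rintro ⟨c, e⟩ h
    simp only [mem_sigma, mem_mats] at h ⊢
    obtain ⟨⟨h1, h2⟩, h3, h4⟩ := h
    refine ⟨⟨fun i => ?_, fun j => ?_⟩, fun _ => trivial, fun k => ?_⟩
    · rw [← h3 i, Fintype.sum_prod_type]
    · rw [Finset.sum_comm]
      simp only [h4, h1]
    · rw [Fintype.sum_prod_type, Finset.sum_comm]
      simp only [h4, h2]
  · rintro ⟨c, e⟩ h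
    simp only [mem_sigma, mem_mats] at h
    have : c = fun q => ∑ k, e ((q.1, q.2), k) := funext fun q => (h.2.1 q).symm
    subst this
    rfl
  · rintro ⟨c, e⟩ h
    simp only [mem_sigma, mem_mats] at h
    have : c = fun q => ∑ i, e (i, (q.1, q.2)) := funext fun q => (h.2.2 q).symm
    subst this
    rfl
  · rintro ⟨c, e⟩ h
    rw [← monom_comp (Equiv.prodAssoc ι κ μ)]
    simp only [mul_assoc]
    rfl

theorem imul_assoc (z w v : DividedPowerAlgebra A F) :
    imul A F (imul A F z w) v = imul A F z (imul A F w v) := by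
  induction z using monom_induction with
  | zero => simp
  | add z z' h h' => simp [h, h']
  | smul r z h => simp [h]
  | mon k x a =>
  induction w using monom_induction with
  | zero => simp
  | add z z' h h' => simp [h, h']
  | smul r z h => simp [h]
  | mon l y b =>
  induction v using monom_induction with
  | zero => simp
  | add z z' h h' => simp [h, h']
  | smul r z h => simp [h]
  | mon m w d => exact imul_assoc_monom x a y b w d

theorem monom_unit (n : ℕ) (x : F) : monom A (fun _ : Unit => x) (fun _ => n) = dp A n x := by
  simp [monom]

theorem mats_unit (n : ℕ) (b : κ → ℕ) (h : ∑ j, b j = n) :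
    mats (fun _ : Unit => n) b = {fun p => b p.2} := by
  ext c
  rw [mem_mats, mem_singleton]
  constructor
  · rintro ⟨-, h2⟩
    funext p
    rw [← h2 p.2, Fintype.sum_unique]
  · rintro rfl
    exact ⟨fun _ => h, fun j => by simp⟩

theorem dp_imul_monom (z : F) (y : κ → F) (b : κ → ℕ) :
    imul A F (dp A (∑ j, b j) z) (monom A y b) = monom A (fun j => z * y j) b := by
  rw [← monom_unit, imul_monom, mats_unit _ b rfl, sum_singleton,
    ← monom_comp (Equiv.punitProd κ)]
  rfl

theorem imul_dp_dp (n : ℕ) (x y : F) : imul A F (dp A n x) (dp A n y) = dp A n (x * y) := by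
  have := dp_imul_monom (A := A) x (fun _ : Unit => y) fun _ => n
  simpa [monom] using this

variable (A F) in
/-- The graded component of degree `n` of the divided power algebra, as a submodule: it is spanned by
the products `γ^{a₁}(x₁) * ⋯ * γ^{aₖ}(xₖ)` with `a₁ + ⋯ + aₖ = n`. -/
noncomputable def piece (n : ℕ) : Submodule A (DividedPowerAlgebra A F) :=
  Submodule.span A {z | ∃ (k : ℕ) (x : Fin k → F) (a : Fin k → ℕ),
    ∑ i, a i = n ∧ z = ∏ i, dp A (a i) (x i)}

theorem monom_mem_piece (x : ι → F) (a : ι → ℕ) : monom A x a ∈ piece A F (∑ i, a i) := by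
  let e := (Fintype.equivFin ι).symm
  refine Submodule.subset_span ⟨_, fun j => x (e j), fun j => a (e j), ?_, ?_⟩
  · exact Fintype.sum_equiv e _ _ fun _ => rfl
  · exact (monom_comp e x a).symm

theorem imul_mem_piece {n : ℕ} {z : DividedPowerAlgebra A F} (hz : z ∈ piece A F n)
    (w : DividedPowerAlgebra A F) : imul A F z w ∈ piece A F n := by
  induction w using monom_induction with
  | zero => simp
  | add w w' h h' => rw [map_add]; exact add_mem h h'
  | smul r w h => rw [map_smul]; exact Submodule.smul_mem _ r h
  | mon l y b =>
  induction hz using Submodule.span_induction with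
  | zero => simp
  | add z z' _ _ h h' => rw [map_add]; exact add_mem h h'
  | smul r z _ h => rw [map_smul]; exact Submodule.smul_mem _ r h
  | mem z hz =>
    obtain ⟨k, x, a, rfl, rfl⟩ := hz
    rw [← monom, imul_monom]
    refine sum_mem fun c hc => ?_
    have : ∑ p, c p = ∑ i, a i := by
      rw [Fintype.sum_prod_type]
      exact Finset.sum_congr rfl fun i _ => (mem_mats.mp hc).1 i
    rw [← this]
    exact monom_mem_piece _ _

theorem one_imul_of_mem {n : ℕ} {z : DividedPowerAlgebra A F} (hz : z ∈ piece A F n) :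
    imul A F (dp A n 1) z = z := by
  induction hz using Submodule.span_induction with
  | zero => simp
  | add z z' _ _ h h' => rw [map_add, h, h']
  | smul r z _ h => rw [map_smul, h]
  | mem z hz =>
    obtain ⟨k, x, a, rfl, rfl⟩ := hz
    have := dp_imul_monom (A := A) 1 x a
    simp only [one_mul] at this
    exact this

variable (A F) in
/-- `Γⁿ_A F`, the degree `n` component of the divided power algebra of the `A`-algebra `F`. Its ring
structure is the internal product, with unit `γⁿ(1)`. -/
def Gamma (n : ℕ) : Type u := piece A F n

noncomputable instance (n : ℕ) : AddCommGroup (Gamma A F n) :=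
  inferInstanceAs (AddCommGroup (piece A F n))

noncomputable instance (n : ℕ) : Module A (Gamma A F n) :=
  inferInstanceAs (Module A (piece A F n))

noncomputable instance (n : ℕ) : CommRing (Gamma A F n) where
  __ := (inferInstance : AddCommGroup (Gamma A F n))
  mul z w := ⟨imul A F z.1 w.1, imul_mem_piece z.2 w.1⟩
  one := ⟨dp A n 1, by simpa [monom] using monom_mem_piece (A := A) (fun _ : Unit => (1 : F)) fun _ => n⟩
  left_distrib z w v := Subtype.ext (map_add (imul A F z.1) w.1 v.1)
  right_distrib z w v := Subtype.ext (LinearMap.map_add₂ (imul A F) z.1 w.1 v.1)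
  zero_mul z := Subtype.ext (LinearMap.map_zero₂ (imul A F) z.1)
  mul_zero z := Subtype.ext (map_zero (imul A F z.1))
  mul_assoc z w v := Subtype.ext (imul_assoc z.1 w.1 v.1)
  mul_comm z w := Subtype.ext (imul_comm z.1 w.1)
  one_mul z := Subtype.ext (one_imul_of_mem z.2)
  mul_one z := Subtype.ext ((imul_comm _ _).trans (one_imul_of_mem z.2))

noncomputable instance (n : ℕ) : Algebra A (Gamma A F n) :=
  Algebra.ofModule
    (fun r z w => Subtype.ext (LinearMap.map_smul₂ (imul A F) r z.1 w.1))
    (fun r z w => Subtype.ext (map_smul (imul A F z.1) r w.1))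

variable (A) in
/-- The universal norm `γⁿ : F → Γⁿ_A F`. -/
noncomputable def gamma (n : ℕ) (x : F) : Gamma A F n :=
  ⟨dp A n x, by simpa [monom] using monom_mem_piece (A := A) (fun _ : Unit => x) fun _ => n⟩

theorem gamma_one (n : ℕ) : gamma A n (1 : F) = 1 := rfl

theorem gamma_mul (n : ℕ) (x y : F) : gamma A n (x * y) = gamma A n x * gamma A n y :=
  Subtype.ext (imul_dp_dp n x y).symm

theorem det_mem_piece {n : ℕ} (x y : Fin n → F) :
    (Matrix.of fun i j => dp A 1 (x i * y j)).det ∈ piece A F n := by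
  rw [Matrix.det_apply]
  refine sum_mem fun σ _ => ?_
  have h := monom_mem_piece (A := A) (fun i => x (σ i) * y i) fun _ => 1
  simp only [sum_const, card_univ, Fintype.card_fin, smul_eq_mul, mul_one] at h
  rw [Units.smul_def]
  exact zsmul_mem h _

/-- `δ(x, y)`, the determinant of the matrix `[γ¹(xᵢ yⱼ)]`, computed with the external product. -/
noncomputable def delta {n : ℕ} (x y : Fin n → F) : Gamma A F n :=
  ⟨(Matrix.of fun i j => dp A 1 (x i * y j)).det, det_mem_piece x y⟩

/-- The ideal of norms `I_V ⊆ Γⁿ_A F` associated to an `A`-submodule `V ⊆ F`: the ideal, for the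
internal product, generated by the `δ(x, y)` with `x₁, …, xₙ, y₁, …, yₙ` in `V`. -/
noncomputable def normIdeal (n : ℕ) (V : Submodule A F) : Ideal (Gamma A F n) :=
  Ideal.span {d | ∃ x y : Fin n → F, (∀ i, x i ∈ V) ∧ (∀ i, y i ∈ V) ∧ d = delta x y}

theorem normIdeal_mono (n : ℕ) {V W : Submodule A F} (h : V ≤ W) :
    normIdeal n V ≤ normIdeal n W :=
  Ideal.span_mono fun _ ⟨x, y, hx, hy, hd⟩ => ⟨x, y, fun i => h (hx i), fun i => h (hy i), hd⟩

end

section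
open TensorProduct

variable {A F : Type u} [CommRing A] [CommRing F] [Algebra A F]

/-- The ideal `I` of `B ⊗ F` is a `B`-valued point of the Hilbert functor of `n` points: the quotient
is locally free of rank `n` (finite projective of constant rank `n`) as a `B`-module. -/
def IsHilbPoint (n : ℕ) {B : Type u} [CommRing B] [Algebra A B] (I : Ideal (B ⊗[A] F)) : Prop :=
  Module.Finite B ((B ⊗[A] F) ⧸ I) ∧ Module.Projective B ((B ⊗[A] F) ⧸ I) ∧
    ∀ p : PrimeSpectrum B, Module.rankAtStalk (R := B) ((B ⊗[A] F) ⧸ I) p = n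

/-- `V ⊆ F` is `n`-sufficiently big: `B ⊗ V → B ⊗ F → E` is surjective for all `A`-algebras `B` and
all `B`-valued points `E` of the Hilbert functor of `n` points. -/
def IsSufficientlyBig (n : ℕ) (V : Submodule A F) : Prop :=
  ∀ (B : Type u) [CommRing B] [Algebra A B] (I : Ideal (B ⊗[A] F)), IsHilbPoint n I →
    Function.Surjective
      ((Ideal.Quotient.mkₐ B I).toLinearMap ∘ₗ V.subtype.baseChange B)

end

section
open Polynomial AlgebraicGeometry CategoryTheory HomogeneousLocalization
variable {R : Type u} [CommRing R]

/-- The degree `m` part `I^m t^m` of the Rees algebra `⊕ I^m t^m ⊆ R[t]`. -/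
noncomputable def reesGrading (I : Ideal R) (m : ℕ) : Submodule R (reesAlgebra I) :=
  (LinearMap.range (Polynomial.monomial (R := R) m)).comap (reesAlgebra I).val.toLinearMap

theorem mem_reesGrading {I : Ideal R} {m : ℕ} {f : reesAlgebra I} :
    f ∈ reesGrading I m ↔ ∃ r, monomial m r = (f : R[X]) := Iff.rfl

/-- The degree `m` component of an element of the Rees algebra. -/
noncomputable def reesComponent {I : Ideal R} (f : reesAlgebra I) (m : ℕ) : reesGrading I m :=
  ⟨⟨monomial m ((f : R[X]).coeff m),
    reesAlgebra.monomial_mem.mpr ((mem_reesAlgebra_iff I f.1).mp f.2 m)⟩, ⟨_, rfl⟩⟩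

theorem coe_reesComponent {I : Ideal R} (f : reesAlgebra I) (m : ℕ) :
    ((reesComponent f m : reesAlgebra I) : R[X]) = monomial m ((f : R[X]).coeff m) := rfl

theorem coe_directSum_apply {I : Ideal R} (x : DirectSum ℕ fun m => reesGrading I m) (m : ℕ) :
    ((x m : reesAlgebra I) : R[X]) = monomial m
      (((DirectSum.coeAddMonoidHom (reesGrading I) x : reesAlgebra I) : R[X]).coeff m) := by
  induction x using DirectSum.induction_on with
  | zero => simp
  | of j y =>
    obtain ⟨r, hr⟩ := mem_reesGrading.mp y.2
    rw [DirectSum.coeAddMonoidHom_of, ← hr]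
    by_cases h : j = m
    · subst h
      rw [DirectSum.of_eq_same, ← hr, coeff_monomial_same]
    · rw [DirectSum.of_eq_of_ne _ _ _ (Ne.symm h), coeff_monomial_of_ne _ (Ne.symm h)]
      simp
  | add x y hx hy =>
    rw [map_add, DirectSum.add_apply]
    simp only [Submodule.coe_add, Subalgebra.coe_add, coeff_add, map_add, hx, hy]

theorem reesComponent_sum {I : Ideal R} (f : reesAlgebra I) :
    DirectSum.coeAddMonoidHom (reesGrading I) (∑ i ∈ (f : R[X]).support,
      DirectSum.of (fun m => reesGrading I m) i (reesComponent f i)) = f := by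
  apply Subtype.ext
  simp only [map_sum, DirectSum.coeAddMonoidHom_of, AddSubmonoidClass.coe_finsetSum,
    coe_reesComponent]
  exact (f : R[X]).as_sum_support.symm

noncomputable instance (I : Ideal R) : GradedAlgebra (reesGrading I) where
  one_mem := ⟨1, rfl⟩
  mul_mem := by
    rintro i j f g ⟨r, hr⟩ ⟨s, hs⟩
    refine ⟨r * s, ?_⟩
    simp only [AlgHom.toLinearMap_apply, Subalgebra.coe_val, MulMemClass.coe_mul] at hr hs ⊢
    rw [← hr, ← hs, monomial_mul_monomial]
  decompose' f := ∑ i ∈ (f : R[X]).support,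
    DirectSum.of (fun m => reesGrading I m) i (reesComponent f i)
  left_inv := reesComponent_sum
  right_inv x := by
    refine DFinsupp.ext fun m => Subtype.ext (Subtype.ext ?_)
    rw [coe_directSum_apply, coe_directSum_apply x, reesComponent_sum]

/-- For ideals `I ≤ J`, the inclusion `⊕ I^m → ⊕ J^m` of Rees algebras as a graded homomorphism. -/
noncomputable def reesInclusion {I J : Ideal R} (h : I ≤ J) : reesGrading I →+*ᵍ reesGrading J where
  __ := (Subalgebra.inclusion (show reesAlgebra I ≤ reesAlgebra J from
    fun _ hf i => Ideal.pow_right_mono h i (hf i))).toRingHom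
  map_mem hx := hx

/-- A morphism `φ : Proj ℬ ⟶ Proj 𝒜` is induced by the graded homomorphism `f : 𝒜 → ℬ` if, for all
homogeneous `a` of positive degree, it restricts on `D₊(f a)` to the morphism to `D₊(a)` given by the
ring homomorphism `(𝒜_a)₀ → (ℬ_{f a})₀`. -/
def IsInducedOnProj {S T σ τ : Type u} [CommRing S] [CommRing T] [SetLike σ S]
    [AddSubgroupClass σ S] [SetLike τ T] [AddSubgroupClass τ T] {𝒜 : ℕ → σ} {ℬ : ℕ → τ}
    [GradedRing 𝒜] [GradedRing ℬ] (f : 𝒜 →+*ᵍ ℬ) (φ : Proj ℬ ⟶ Proj 𝒜) : Prop :=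
  ∀ (m : ℕ) (hm : 0 < m) (a : S) (ha : a ∈ 𝒜 m),
    Proj.awayι ℬ (f a) (f.2 ha) hm ≫ φ =
      Spec.map (CommRingCat.ofHom (Away.map f a)) ≫ Proj.awayι 𝒜 a ha hm

end

end NormBlowup

set_option autoImplicit false

/-! Finiteness is proved as "proper and affine". Both Rees algebras have degree zero part `Γ`, so a
morphism induced by `ι` is a morphism over `Spec Γ`. If `I_F` is finitely generated, the source is
proper over `Spec Γ`; the target is separated, so the morphism is proper. It is affine because the
preimage of `D₊(a)` is `D₊(ι a)`. What remains is that the `D₊(ι a)` cover the source and that `I_F`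
is finitely generated.

Both rest on traces. With `n + 1` in place of `n`, put `Tr(u) = γ¹(u) * γⁿ(1)` in `Γⁿ⁺¹`. Then `δ(x,
y)` is the determinant, for the internal product, of the matrix `Tr(xᵢ yⱼ)` (`delta_eq_det_trace`),
and such determinants of size `n + 2` vanish (`det_trace_eq_zero`): the trace form behaves like a
form of rank at most `n + 1`.

Finite generation: a Cayley–Hamilton relation for traces writes the form `Tr(xⁿ⁺¹ z ·)` through the
`Tr(xʲ z ·)` with `j ≤ n`, so monomials with exponents at most `n` in algebra generators of `F`
suffice for the entries of `δ` (`normIdeal_top_fg`).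

Covering: take a point of the source and the map `ψ` from the Rees algebra to its residue field `K`
as a prime ideal. Some `δ(x, y)t` is nonzero under `ψ`. Cramer's rule suggests the map `F → Kⁿ⁺¹`
whose `i`-th coordinate is `ψ` of `δ(x, y)t` with `xᵢ` replaced by `f`. The exchange identity
`delta_exchange` shows that its `K`-linear extension has an ideal as kernel, and it is surjective,
so it gives a rank `n + 1` quotient algebra of `K ⊗ F`. As `V` is sufficiently big, each coordinate
is nonzero on some element of `V`. So the entries of `x` can be moved into `V` one at a time, then
those of `y` by symmetry. -/

namespace NormBlowup

/-! ### Morphisms of Proj induced by a graded homomorphism -/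

section
open AlgebraicGeometry CategoryTheory HomogeneousLocalization Graded

variable {S T σ τ : Type u} [CommRing S] [CommRing T] [SetLike σ S] [AddSubgroupClass σ S]
  [SetLike τ T] [AddSubgroupClass τ T] {𝒜 : ℕ → σ} {ℬ : ℕ → τ} [GradedRing 𝒜] [GradedRing ℬ]
  {f : 𝒜 →+*ᵍ ℬ}

/-- The morphism `D₊(f a) ⟶ Proj 𝒜` induced by a graded homomorphism `f`. -/
noncomputable def inducedOnAway (f : 𝒜 →+*ᵍ ℬ) {m : ℕ} (hm : 0 < m) (a : S) (ha : a ∈ 𝒜 m) :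
    Spec (.of (Away ℬ (f a))) ⟶ Proj 𝒜 :=
  Spec.map (CommRingCat.ofHom (Away.map f a)) ≫ Proj.awayι 𝒜 a ha hm

theorem awayMap_comp_map {a b : S} {k : ℕ} (hb : b ∈ 𝒜 k) {m : ℕ} (ha : a ∈ 𝒜 m) :
    (awayMap ℬ (map_mem f hb) (map_mul f a b)).comp (Away.map f a) =
      (Away.map f (a * b)).comp (awayMap 𝒜 hb rfl) := by
  ext x : 1
  obtain ⟨n, s, hs, rfl⟩ := Away.mk_surjective 𝒜 ha x
  simp only [RingHom.comp_apply, Away.map_mk, awayMap_mk]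
  ext
  simp [Away.val_mk]

/-- The product is a variable `x` with its own degree `l`, so that `a * b` and `b * a` can both be
matched to the same element on an overlap. -/
theorem awayMap_inducedOnAway {a b x : S} {k m l : ℕ} (ha : a ∈ 𝒜 m) (hb : b ∈ 𝒜 k)
    (hm : 0 < m) (hx : x = a * b) (hfx : f x = f a * f b) (hl : l = m + k) (hl' : 0 < l)
    (hxl : x ∈ 𝒜 l) :
    Spec.map (CommRingCat.ofHom (awayMap ℬ (map_mem f hb) hfx)) ≫ inducedOnAway f hm a ha =
      inducedOnAway f hl' x hxl := by
  subst hx hl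
  rw [inducedOnAway, inducedOnAway, ← Category.assoc, ← Spec.map_comp, ← CommRingCat.ofHom_comp,
    awayMap_comp_map hb ha, CommRingCat.ofHom_comp, Spec.map_comp, Category.assoc,
    Proj.SpecMap_awayMap_awayι 𝒜 ha hm hb rfl]

/-- The gluing condition: the overlap of `D₊(f a)` and `D₊(f b)` is `D₊(f (a * b))`, where both
morphisms restrict to the one defined by `a * b`. -/
theorem pullback_inducedOnAway {a b : S} {k m : ℕ} (ha : a ∈ 𝒜 m) (hb : b ∈ 𝒜 k)
    (hm : 0 < m) (hk : 0 < k) :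
    Limits.pullback.fst (Proj.awayι ℬ (f a) (map_mem f ha) hm)
        (Proj.awayι ℬ (f b) (map_mem f hb) hk) ≫ inducedOnAway f hm a ha =
      Limits.pullback.snd _ _ ≫ inducedOnAway f hk b hb := by
  rw [← Proj.pullbackAwayιIso_hom_SpecMap_awayMap_left ℬ (map_mem f ha) hm (map_mem f hb) hk
    (map_mul f a b), ← Proj.pullbackAwayιIso_hom_SpecMap_awayMap_right ℬ (map_mem f ha) hm
    (map_mem f hb) hk (map_mul f a b), Category.assoc, Category.assoc,
    awayMap_inducedOnAway ha hb hm rfl (map_mul f a b) rfl (hm.trans_le (m.le_add_right k))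
      (SetLike.mul_mem_graded ha hb),
    awayMap_inducedOnAway hb ha hk (mul_comm a b) _ (add_comm m k)]

variable (𝒜) in
/-- A homogeneous element of positive degree. -/
structure PosHomogeneous where
  /-- The degree. -/
  deg : ℕ
  pos : 0 < deg
  /-- The element. -/
  elt : S
  mem : elt ∈ 𝒜 deg

/-- The affine open cover of `Proj ℬ` by the `D₊(f a)`. -/
noncomputable def imageCover (f : 𝒜 →+*ᵍ ℬ)
    (hf : ∀ p : Proj ℬ, ∃ m : ℕ, 0 < m ∧ ∃ a ∈ 𝒜 m, f a ∉ p.asHomogeneousIdeal) :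
    (Proj ℬ).AffineOpenCover where
  I₀ := PosHomogeneous 𝒜
  X i := .of (Away ℬ (f i.elt))
  f i := Proj.awayι ℬ (f i.elt) (map_mem f i.mem) i.pos
  idx x := ⟨_, (hf x).choose_spec.1, _, (hf x).choose_spec.2.choose_spec.1⟩
  covers x := by
    change x ∈ (Proj.awayι ℬ _ _ _).opensRange
    have h := (hf x).choose_spec.2.choose_spec
    exact (Proj.opensRange_awayι ℬ _ (map_mem f h.1) (hf x).choose_spec.1).ge h.2
  map_prop i := inferInstanceAs
    (IsOpenImmersion (Proj.awayι ℬ (f i.elt) (map_mem f i.mem) i.pos))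

theorem hom_ext_of_imageCover
    (hf : ∀ p : Proj ℬ, ∃ m : ℕ, 0 < m ∧ ∃ a ∈ 𝒜 m, f a ∉ p.asHomogeneousIdeal)
    {Z : Scheme.{u}} {φ ψ : Proj ℬ ⟶ Z}
    (h : ∀ (m : ℕ) (hm : 0 < m) (a : S) (ha : a ∈ 𝒜 m),
      Proj.awayι ℬ (f a) (map_mem f ha) hm ≫ φ = Proj.awayι ℬ (f a) (map_mem f ha) hm ≫ ψ) :
    φ = ψ :=
  (imageCover f hf).openCover.hom_ext _ _ fun i => h i.deg i.pos i.elt i.mem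

theorem IsInducedOnProj.unique
    (hf : ∀ p : Proj ℬ, ∃ m : ℕ, 0 < m ∧ ∃ a ∈ 𝒜 m, f a ∉ p.asHomogeneousIdeal)
    {φ ψ : Proj ℬ ⟶ Proj 𝒜} (hφ : IsInducedOnProj f φ) (hψ : IsInducedOnProj f ψ) : φ = ψ :=
  hom_ext_of_imageCover hf fun m hm a ha => (hφ m hm a ha).trans (hψ m hm a ha).symm

theorem exists_isInducedOnProj
    (hf : ∀ p : Proj ℬ, ∃ m : ℕ, 0 < m ∧ ∃ a ∈ 𝒜 m, f a ∉ p.asHomogeneousIdeal) :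
    ∃ φ : Proj ℬ ⟶ Proj 𝒜, IsInducedOnProj f φ :=
  ⟨(imageCover f hf).openCover.glueMorphisms (fun i => inducedOnAway f i.pos i.elt i.mem)
    fun i j => pullback_inducedOnAway i.mem j.mem i.pos j.pos,
    fun m hm a ha => (imageCover f hf).openCover.ι_glueMorphisms _ _ ⟨m, hm, a, ha⟩⟩

/-- On the chart `D₊(f b)` both sides are the basic open set of a degree zero fraction of powers of
`f a` and `f b`, and `Away.map f b` matches the fraction for `a` and `b` with the one for their
images. -/
theorem IsInducedOnProj.preimage_basicOpen
    (hf : ∀ p : Proj ℬ, ∃ m : ℕ, 0 < m ∧ ∃ a ∈ 𝒜 m, f a ∉ p.asHomogeneousIdeal)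
    {φ : Proj ℬ ⟶ Proj 𝒜} (hφ : IsInducedOnProj f φ) {m : ℕ} (hm : 0 < m) {a : S} (ha : a ∈ 𝒜 m) :
    φ ⁻¹ᵁ Proj.basicOpen 𝒜 a = Proj.basicOpen ℬ (f a) := by
  ext x
  obtain ⟨k, hk, b, hb, hx⟩ := hf x
  obtain ⟨y, rfl⟩ := (Proj.opensRange_awayι ℬ (f b) (map_mem f hb) hk).ge hx
  have h1 := SetLike.ext_iff.mp
    (Proj.awayι_preimage_basicOpen ℬ (map_mem f hb) hk (map_mem f ha) hm) y
  have h2 := SetLike.ext_iff.mp (Proj.awayι_preimage_basicOpen 𝒜 hb hk ha hm)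
    (Spec.map (CommRingCat.ofHom (Away.map f b)) y)
  have h3 := congrArg (fun ψ => ψ y) (hφ k hk b hb)
  have h4 : Away.map f b (Away.isLocalizationElem hb ha) =
      Away.isLocalizationElem (map_mem f hb) (map_mem f ha) := by
    simp [Away.isLocalizationElem]
  refine Iff.trans ?_ h1.symm
  rw [← h4]
  exact Iff.trans (iff_of_eq (congrArg (· ∈ Proj.basicOpen 𝒜 a) h3)) h2

theorem IsInducedOnProj.isAffineHom
    (hf : ∀ p : Proj ℬ, ∃ m : ℕ, 0 < m ∧ ∃ a ∈ 𝒜 m, f a ∉ p.asHomogeneousIdeal)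
    {φ : Proj ℬ ⟶ Proj 𝒜} (hφ : IsInducedOnProj f φ) : IsAffineHom φ := by
  have h : ⨆ i : PosHomogeneous 𝒜, Proj.basicOpen 𝒜 i.elt = ⊤ := by
    refine top_le_iff.mp fun x _ => ?_
    obtain ⟨y, hy⟩ := (Proj.affineOpenCover 𝒜).openCover.covers x
    exact TopologicalSpace.Opens.mem_iSup.mpr ⟨⟨_, PNat.pos _, _, Subtype.property _⟩,
      (Proj.opensRange_awayι 𝒜 _ (Subtype.property _) (PNat.pos _)).le ⟨y, hy⟩⟩
  refine isAffineHom_of_forall_exists_isAffineOpen _ fun x => ?_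
  obtain ⟨i, hi⟩ := TopologicalSpace.Opens.mem_iSup.mp (h.ge (Set.mem_univ x))
  refine ⟨_, hi, Proj.isAffineOpen_basicOpen 𝒜 _ i.mem i.pos, ?_⟩
  rw [hφ.preimage_basicOpen hf i.pos i.mem]
  exact Proj.isAffineOpen_basicOpen ℬ _ (map_mem f i.mem) i.pos

theorem IsInducedOnProj.comp_toSpecZero
    (hf : ∀ p : Proj ℬ, ∃ m : ℕ, 0 < m ∧ ∃ a ∈ 𝒜 m, f a ∉ p.asHomogeneousIdeal)
    {φ : Proj ℬ ⟶ Proj 𝒜} (hφ : IsInducedOnProj f φ) (g : 𝒜 0 →+* ℬ 0)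
    (hg : ∀ x, (g x : T) = f x) :
    φ ≫ Proj.toSpecZero 𝒜 = Proj.toSpecZero ℬ ≫ Spec.map (CommRingCat.ofHom g) := by
  refine hom_ext_of_imageCover hf fun m hm a ha => ?_
  have h : Proj.awayι ℬ (f a) (map_mem f ha) hm ≫ φ = _ := hφ m hm a ha
  rw [reassoc_of% h, Proj.awayι_toSpecZero, ← Category.assoc, Proj.awayι_toSpecZero,
    ← Spec.map_comp, ← Spec.map_comp, ← CommRingCat.ofHom_comp, ← CommRingCat.ofHom_comp]
  congr 2
  ext x
  change val (mk ⟨0, ⟨f x, map_mem f x.2⟩, ⟨f 1, map_mem f (SetLike.one_mem_graded 𝒜)⟩, _⟩) =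
    val (mk ⟨0, g x, 1, _⟩)
  simp [hg]

/-- Surjectivity in degree zero makes `Spec g` a closed immersion, so the source is proper over the
degree zero spectrum of the target. Properness then passes to `φ` since `Proj 𝒜` is separated over
that spectrum. -/
theorem IsInducedOnProj.isFinite [Algebra.FiniteType (ℬ 0) T]
    (hf : ∀ p : Proj ℬ, ∃ m : ℕ, 0 < m ∧ ∃ a ∈ 𝒜 m, f a ∉ p.asHomogeneousIdeal)
    (h0 : ∀ y ∈ ℬ 0, ∃ x ∈ 𝒜 0, f x = y)
    {φ : Proj ℬ ⟶ Proj 𝒜} (hφ : IsInducedOnProj f φ) : IsFinite φ := by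
  let g : 𝒜 0 →+* ℬ 0 :=
    { toFun x := ⟨f x, f.2 x.2⟩
      map_one' := Subtype.ext (map_one f)
      map_mul' x y := Subtype.ext (map_mul f x.1 y.1)
      map_zero' := Subtype.ext (map_zero f)
      map_add' x y := Subtype.ext (map_add f x.1 y.1) }
  have hg : Function.Surjective g := by
    rintro ⟨y, hy⟩
    obtain ⟨x, hx, rfl⟩ := h0 y hy
    exact ⟨⟨x, hx⟩, rfl⟩
  have : IsClosedImmersion (Spec.map (CommRingCat.ofHom g)) :=
    IsClosedImmersion.spec_of_surjective _ hg
  have : IsProper (φ ≫ Proj.toSpecZero 𝒜) := by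
    rw [hφ.comp_toSpecZero hf g fun _ => rfl]
    infer_instance
  rw [IsFinite.iff_isProper_and_isAffineHom]
  exact ⟨.of_comp φ (Proj.toSpecZero 𝒜), hφ.isAffineHom hf⟩

end

/-! ### The elements δ as determinants of traces -/

section
open DividedPowerAlgebra (dp)
open Finset

variable {A F : Type u} [CommRing A] [CommRing F] [Algebra A F]

/-- A matrix with row sums `a` and column sums `1` and `n` is fixed by the row `i` in which its
first column has the entry `1`; this row must have `a i ≠ 0`. So multiplication by a trace acts like
a derivation, multiplying one of the factors by `u`. -/
theorem imul_trace_monom {ι : Type} [Fintype ι] [DecidableEq ι] (n : ℕ) (u : F) (x : ι → F)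
    (a : ι → ℕ) (ha : ∑ i, a i = n + 1) :
    imul A F (monom A x a) (dp A 1 u * dp A n 1) =
      ∑ i, if a i = 0 then 0 else
        dp A 1 (x i * u) * monom A x (Function.update a i (a i - 1)) := by
  have h : dp A 1 u * dp A n 1 = monom A ![u, 1] ![1, n] := by
    simp [monom]
  rw [h, imul_monom, Finset.sum_ite, Finset.sum_const_zero, zero_add]
  symm
  have hmem (i : ι) (hi : a i ≠ 0) :
      (fun p : ι × Fin 2 =>
        ![(Pi.single i 1 : ι → ℕ) p.1, Function.update a i (a i - 1) p.1] p.2) ∈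
        mats a ![1, n] := by
    have h1 : ∑ j, Function.update a i (a i - 1) j = n := by
      have h2 := Finset.sum_update_of_mem (mem_univ i) a (a i - 1)
      have h3 := Finset.add_sum_erase univ a (mem_univ i)
      rw [Finset.sdiff_singleton_eq_erase] at h2
      omega
    rw [mem_mats, Fin.forall_fin_two]
    refine ⟨fun j => ?_, by simp, by simpa using h1⟩
    rcases eq_or_ne j i with rfl | hj
    · simp; omega
    · simp [hj]
  refine Finset.sum_bij (fun i _ p =>
    ![(Pi.single i 1 : ι → ℕ) p.1, Function.update a i (a i - 1) p.1] p.2) ?_ ?_ ?_ ?_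
  · intro i hi
    exact hmem i (mem_filter.mp hi).2
  · intro i _ j _ hij
    by_contra hne
    have := congrFun hij (i, 0)
    simp [hne] at this
  · intro c hc
    rw [mem_mats, Fin.forall_fin_two] at hc
    obtain ⟨h1, h2, -⟩ := hc
    simp only [Fin.sum_univ_two] at h1
    simp only [Matrix.cons_val_zero] at h2
    obtain ⟨i, hi⟩ : ∃ i, c (i, 0) ≠ 0 := by
      by_contra! h0
      simp [h0] at h2
    have h3 := Finset.add_sum_erase univ (fun j => c (j, 0)) (mem_univ i)
    simp only [h2] at h3
    have h4 : ∀ j, j ≠ i → c (j, 0) = 0 := by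
      have : ∑ j ∈ univ.erase i, c (j, 0) = 0 := by omega
      intro j hj
      exact Finset.sum_eq_zero_iff.mp this j (by simp [hj])
    have h5 := h1 i
    refine ⟨i, by simp; omega, ?_⟩
    ext ⟨j, k⟩
    have h6 := h1 j
    rcases eq_or_ne j i with rfl | hj
    · fin_cases k <;> simp <;> omega
    · have := h4 j hj
      fin_cases k <;> simp [hj] <;> omega
  · intro i _
    simp only [Fintype.prod_prod_type, Fin.prod_univ_two, Matrix.cons_val_zero,
      Matrix.cons_val_one, mul_one,
      Finset.prod_mul_distrib, monom]
    congr 1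
    rw [Finset.prod_eq_single i]
    · simp
    · intro j _ hj
      simp [hj, DividedPowerAlgebra.dp_zero]
    · simp

variable (A F) in
/-- The inclusion of `Γⁿ` in the divided power algebra. -/
noncomputable def Gamma.toDP (n : ℕ) : Gamma A F n →ₗ[A] DividedPowerAlgebra A F :=
  (piece A F n).subtype

theorem Gamma.toDP_injective (n : ℕ) : Function.Injective (Gamma.toDP A F n) :=
  Subtype.val_injective

theorem Gamma.toDP_one (n : ℕ) : Gamma.toDP A F n 1 = dp A n 1 := rfl

theorem Gamma.toDP_mul {n : ℕ} (z w : Gamma A F n) : Gamma.toDP A F n (z * w) =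
    imul A F (Gamma.toDP A F n z) (Gamma.toDP A F n w) := rfl

variable (A) in
/-- The trace `γ¹(u) * γⁿ(1)` in `Γⁿ⁺¹`. -/
noncomputable def trace (n : ℕ) (u : F) : Gamma A F (n + 1) :=
  ⟨dp A 1 u * dp A n 1, by
    simpa [monom, add_comm] using monom_mem_piece (A := A) ![u, 1] ![1, n]⟩

theorem toDP_trace (n : ℕ) (u : F) :
    Gamma.toDP A F (n + 1) (trace A n u) = dp A 1 u * dp A n 1 := rfl

variable (A) in
/-- The element `γ¹(u₁) * ⋯ * γ¹(uₘ) * γⁿ⁻ᵐ(1)` of `Γⁿ`, the product being over a finite set `s`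
with `m` elements; it is zero if `m > n`. -/
noncomputable def partialProd {ι : Type} (n : ℕ) (s : Finset ι) (u : ι → F) :
    Gamma A F n :=
  ⟨if s.card ≤ n then dp A (n - s.card) 1 * ∏ i ∈ s, dp A 1 (u i) else 0, by
    classical
    split_ifs with h
    · have := monom_mem_piece (A := A) (fun o : Option s => o.elim (1 : F) fun i => u i)
        (fun o : Option s => o.elim (n - s.card) fun _ => 1)
      rw [monom] at this
      simp only [Fintype.prod_option, Fintype.sum_option, Option.elim_none, Option.elim_some,
        sum_const, card_univ, Fintype.card_coe, smul_eq_mul, mul_one,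
        Nat.sub_add_cancel h] at this
      rwa [← Finset.prod_coe_sort]
    · exact zero_mem _⟩

theorem toDP_partialProd {ι : Type} (n : ℕ) (s : Finset ι) (u : ι → F) :
    Gamma.toDP A F n (partialProd A n s u) =
      if s.card ≤ n then dp A (n - s.card) 1 * ∏ i ∈ s, dp A 1 (u i) else 0 := rfl

theorem partialProd_congr {ι : Type} {n : ℕ} {s : Finset ι} {u v : ι → F}
    (h : ∀ i ∈ s, u i = v i) : partialProd A n s u = partialProd A n s v := by
  refine Gamma.toDP_injective _ ?_
  simp only [toDP_partialProd]
  congr 2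
  exact Finset.prod_congr rfl fun i hi => by rw [h i hi]

/-- The trace multiplies one factor by `u a`: either one of the padding factors `1`, which adds `a`
to the set, or one of the `u i` with `i ∈ s`. -/
theorem trace_mul_partialProd {ι : Type} [Fintype ι] [DecidableEq ι] (n : ℕ) (s : Finset ι)
    (u : ι → F) {a : ι} (ha : a ∉ s) :
    partialProd A (n + 1) s u * trace A n (u a) = partialProd A (n + 1) (insert a s) u +
      ∑ i ∈ s, partialProd A (n + 1) s (Function.update u i (u i * u a)) := by
  refine Gamma.toDP_injective _ ?_
  rw [map_add, map_sum, Gamma.toDP_mul, toDP_trace]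
  by_cases hs : s.card ≤ n + 1
  swap
  · have : ¬ (insert a s).card ≤ n + 1 := by rw [card_insert_of_notMem ha]; omega
    simp [toDP_partialProd, hs, this]
  -- The index `none` carries the padding `γᶜ(1)`, and indices outside `s` get exponent `0`.
  have hprod (c : ℕ) (v : ι → F) : dp A c (1 : F) * ∏ i ∈ s, dp A 1 (v i) =
      monom A (fun o : Option ι => o.elim 1 v)
        (fun o => o.elim c fun i => if i ∈ s then 1 else 0) := by
    rw [monom, Fintype.prod_option]
    congr 1
    rw [← Finset.prod_subset (subset_univ s)]
    · exact Finset.prod_congr rfl fun i hi => by simp [hi]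
    · intro i _ hi
      simp [hi, DividedPowerAlgebra.dp_zero]
  have hcoe (v : ι → F) : Gamma.toDP A F _ (partialProd A (n + 1) s v) =
      dp A (n + 1 - s.card) 1 * ∏ i ∈ s, dp A 1 (v i) := if_pos hs
  simp only [hcoe]
  rw [hprod, imul_trace_monom n _ _ _ (by simp [Fintype.sum_option]; omega), Fintype.sum_option]
  congr 1
  · simp only [Option.elim_none, one_mul]
    rw [toDP_partialProd]
    simp only [card_insert_of_notMem ha]
    -- In the first case no padding is left, and both terms vanish.
    by_cases h : n + 1 - s.card = 0
    · rw [if_pos h, if_neg (by omega)]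
    · rw [if_neg h, if_pos (by omega), prod_insert ha, mul_left_comm, Nat.sub_add_eq, hprod]
      congr 2
      ext o
      cases o <;> simp
  · simp only [Option.elim_some, ite_eq_right_iff, one_ne_zero, imp_false]
    rw [← Finset.sum_subset (subset_univ s)]
    · refine Finset.sum_congr rfl fun i hi => ?_
      rw [if_neg (by simp [hi]), monom, Fintype.prod_option, mul_left_comm]
      congr 1
      rw [← Finset.mul_prod_erase s _ hi, Function.update_self]
      congr 1
      rw [← Finset.prod_subset (subset_univ (s.erase i))]
      · refine Finset.prod_congr rfl fun j hj => ?_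
        rw [mem_erase] at hj
        simp [hj.1, hj.2]
      · intro j _ hj
        rw [mem_erase, not_and_or, not_not] at hj
        rcases eq_or_ne j i with rfl | hne
        · simp [hi, DividedPowerAlgebra.dp_zero]
        · simp [hne, hj.resolve_left hne, DividedPowerAlgebra.dp_zero]
    · intro i _ hi
      simp [hi]

theorem sum_sign_mul_swap {G : Type*} [AddCommGroup G] {ι : Type} [Fintype ι] [DecidableEq ι]
    {i a : ι} (h : i ≠ a) (P : Equiv.Perm ι → G) (hP : ∀ σ, P (σ * Equiv.swap i a) = P σ) :
    ∑ σ : Equiv.Perm ι, Equiv.Perm.sign σ • P σ = 0 := by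
  refine Finset.sum_involution (fun σ _ => σ * Equiv.swap i a) ?_ ?_ ?_ ?_
  · intro σ _
    rw [hP, Equiv.Perm.sign_mul, Equiv.Perm.sign_swap h]
    simp
  · intro σ _ _ hσ
    rw [mul_eq_left] at hσ
    exact h (Equiv.swap_eq_one_iff.mp hσ)
  · simp
  · intro σ _
    simp [mul_assoc]

/-- A signed sum interpolating between a determinant of traces and an external determinant. -/
noncomputable def mixedDet {ι : Type} [Fintype ι] [DecidableEq ι] (n : ℕ) (x y : ι → F)
    (s : Finset ι) : Gamma A F (n + 1) :=
  ∑ σ : Equiv.Perm ι, Equiv.Perm.sign σ •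
    (partialProd A (n + 1) s (fun i => x (σ i) * y i) *
      ∏ i ∈ sᶜ, trace A n (x (σ i) * y i))

/-- The correction terms contain `x (σ i) * y i * (x (σ a) * y a)`, which does not change when `σ`
is composed with the swap of `i` and `a`, so they cancel in the signed sum. -/
theorem mixedDet_insert {ι : Type} [Fintype ι] [DecidableEq ι] (n : ℕ) (x y : ι → F)
    (s : Finset ι) {a : ι} (ha : a ∉ s) :
    mixedDet (A := A) n x y s = mixedDet n x y (insert a s) := by
  have h1 (σ : Equiv.Perm ι) : partialProd A (n + 1) s (fun i => x (σ i) * y i) *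
      ∏ i ∈ sᶜ, trace A n (x (σ i) * y i) =
      partialProd A (n + 1) (insert a s) (fun i => x (σ i) * y i) *
        ∏ i ∈ (insert a s)ᶜ, trace A n (x (σ i) * y i) +
      ∑ i ∈ s, partialProd A (n + 1) s (Function.update (fun i => x (σ i) * y i) i
        (x (σ i) * y i * (x (σ a) * y a))) *
        ∏ i ∈ (insert a s)ᶜ, trace A n (x (σ i) * y i) := by
    rw [compl_insert, ← Finset.mul_prod_erase sᶜ _ (mem_compl.mpr ha), ← mul_assoc,
      trace_mul_partialProd n s (fun i => x (σ i) * y i) ha, add_mul, sum_mul]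
  simp only [mixedDet, h1, smul_add, sum_add_distrib, smul_sum]
  rw [add_eq_left, Finset.sum_comm]
  refine Finset.sum_eq_zero fun i hi => ?_
  have hia : i ≠ a := fun h => ha (h ▸ hi)
  refine sum_sign_mul_swap hia _ fun σ => ?_
  congr 1
  · refine partialProd_congr fun j hj => ?_
    have hja : j ≠ a := fun h => ha (h ▸ hj)
    rcases eq_or_ne j i with rfl | hji
    · simp; ring
    · simp [hji, Equiv.swap_apply_of_ne_of_ne hji hja]
  · refine Finset.prod_congr rfl fun j hj => ?_
    rw [mem_compl, mem_insert, not_or] at hj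
    have hji : j ≠ i := fun h => hj.2 (h ▸ hi)
    simp [Equiv.swap_apply_of_ne_of_ne hji hj.1]

/-- `mixedDet` does not depend on the set: the empty set gives the determinant of traces, the full
set the external sum. -/
theorem det_trace {ι : Type} [Fintype ι] [DecidableEq ι] (n : ℕ) (x y : ι → F) :
    (Matrix.of fun i j => trace A n (x i * y j)).det = ∑ σ : Equiv.Perm ι, Equiv.Perm.sign σ •
      partialProd A (n + 1) univ (fun i => x (σ i) * y i) := by
  have h0 (s : Finset ι) : mixedDet (A := A) n x y s = mixedDet n x y ∅ := by
    induction s using Finset.induction_on with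
    | empty => rfl
    | insert a s ha ih => rw [← mixedDet_insert n x y s ha, ih]
  have h1 (u : ι → F) : partialProd A (n + 1) ∅ u = 1 := by
    refine Gamma.toDP_injective _ ?_
    simp [toDP_partialProd, Gamma.toDP_one]
  have h2 := h0 univ
  simp only [mixedDet, h1, compl_univ, prod_empty, mul_one, one_mul, compl_empty] at h2
  rw [h2, Matrix.det_apply]
  rfl

theorem delta_eq_det_trace (n : ℕ) (x y : Fin (n + 1) → F) :
    delta (A := A) x y = (Matrix.of fun i j => trace A n (x i * y j)).det := by
  rw [det_trace]
  refine Gamma.toDP_injective _ ?_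
  change (Matrix.of fun i j => dp A 1 (x i * y j)).det = _
  rw [map_sum, Matrix.det_apply]
  refine Finset.sum_congr rfl fun σ _ => ?_
  rw [Units.smul_def, Units.smul_def, map_zsmul, toDP_partialProd]
  simp [DividedPowerAlgebra.dp_zero]

/-- The external product of `n + 2` elements of degree one does not fit in degree `n + 1`, where
`partialProd` is zero. -/
theorem det_trace_eq_zero (n : ℕ) (x y : Fin (n + 2) → F) :
    (Matrix.of fun i j => trace A n (x i * y j)).det = 0 := by
  rw [det_trace]
  refine Finset.sum_eq_zero fun σ _ => ?_
  have : partialProd A (n + 1) univ (fun i => x (σ i) * y i) = 0 :=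
    Gamma.toDP_injective _ ((toDP_partialProd _ _ _).trans (by simp))
  rw [this, smul_zero]

end

/-! ### Finite generation of the ideal of norms of F -/

section
open DividedPowerAlgebra (dp)
open Finset

variable {A F : Type u} [CommRing A] [CommRing F] [Algebra A F]

variable (A F) in
/-- The trace as an `A`-linear map. -/
noncomputable def traceLinear (n : ℕ) : F →ₗ[A] Gamma A F (n + 1) where
  toFun := trace A n
  map_add' u v := by
    refine Gamma.toDP_injective _ ?_
    rw [map_add]
    simp only [toDP_trace, ← DividedPowerAlgebra.embed_def, map_add, add_mul]
  map_smul' r u := by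
    refine Gamma.toDP_injective _ ?_
    rw [map_smul]
    simp only [toDP_trace, ← DividedPowerAlgebra.embed_def, map_smul, smul_mul_assoc,
      RingHom.id_apply]

theorem traceLinear_apply (n : ℕ) (u : F) : traceLinear A F n u = trace A n u := rfl

/-- The degree condition stands inside the existential so that `choose` yields families for all
indices, with irrelevant values in the wrong degrees. -/
theorem exists_toDP_eq_monom {ι : Type} [Fintype ι] (n : ℕ) (x : ι → F) (a : ι → ℕ) :
    ∃ z : Gamma A F n, ∑ i, a i = n → Gamma.toDP A F n z = monom A x a := by
  by_cases h : ∑ i, a i = n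
  · subst h
    exact ⟨⟨_, monom_mem_piece x a⟩, fun _ => rfl⟩
  · exact ⟨0, fun h' => absurd h' h⟩

/-- Here `e i` is the elementary symmetric function `γⁱ(x) * γⁿ⁺¹⁻ⁱ(1)` and `h i w` is `γ¹(w) *
γⁱ(x) * γⁿ⁻ⁱ(1)`. In the product with the trace of `w`, the factor `w` hits either an `x` or a `1`;
for `e (n + 1)` there is no `1` left. -/
theorem exists_hook (n : ℕ) (x : F) : ∃ (e : ℕ → Gamma A F (n + 1)) (h : ℕ → F → Gamma A F (n + 1)),
    (∀ w, h 0 w = trace A n w) ∧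
    (∀ i < n, ∀ w, e (i + 1) * trace A n w = h i (x * w) + h (i + 1) w) ∧
    ∀ w, e (n + 1) * trace A n w = h n (x * w) := by
  choose e he using fun i : ℕ => exists_toDP_eq_monom (A := A) (n + 1) ![x, 1] ![i, n + 1 - i]
  choose h hh using fun (i : ℕ) (w : F) =>
    exists_toDP_eq_monom (A := A) (n + 1) ![w, x, 1] ![1, i, n - i]
  have hh' (i : ℕ) (hi : i ≤ n) (w : F) : Gamma.toDP A F _ (h i w) =
      dp A 1 w * (dp A i x * dp A (n - i) 1) := by
    rw [hh i w (by simp [Fin.sum_univ_three]; omega)]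
    simp [monom, Fin.prod_univ_three, mul_assoc]
  refine ⟨e, h, fun w => ?_, fun i hi w => ?_, fun w => ?_⟩
  · refine Gamma.toDP_injective _ ?_
    rw [hh' 0 (Nat.zero_le n), toDP_trace]
    simp [DividedPowerAlgebra.dp_zero]
  · refine Gamma.toDP_injective _ ?_
    have hs : ∑ k, ![i + 1, n + 1 - (i + 1)] k = n + 1 := by simp; omega
    rw [map_add, hh' i hi.le, hh' (i + 1) hi, Gamma.toDP_mul, he _ hs, toDP_trace,
      imul_trace_monom _ _ _ _ hs]
    have h1 : n - i ≠ 0 := by omega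
    simp [monom, Nat.sub_eq_zero_iff_le, hi, Nat.sub_sub]
  · refine Gamma.toDP_injective _ ?_
    have hs : ∑ k, ![n + 1, n + 1 - (n + 1)] k = n + 1 := by simp
    rw [hh' n le_rfl, Gamma.toDP_mul, he _ hs, toDP_trace, imul_trace_monom _ _ _ _ hs]
    simp [monom]

variable (A) in
/-- The function `z ↦ Tr(w z)` attached to `w`. -/
noncomputable def traceForm (n : ℕ) (w : F) : F → Gamma A F (n + 1) := fun z => trace A n (w * z)

variable (A F) in
/-- `traceForm` as an `A`-linear map. -/
noncomputable def traceFormLinear (n : ℕ) : F →ₗ[A] F → Gamma A F (n + 1) :=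
  LinearMap.pi fun z => traceLinear A F n ∘ₗ LinearMap.mulRight A z

theorem traceFormLinear_apply (n : ℕ) (w : F) :
    traceFormLinear A F n w = traceForm A n w := rfl

/-- The Cayley–Hamilton relation for traces, from the alternating sum of the relations of
`exists_hook`. -/
theorem traceForm_pow_mul_mem (n : ℕ) (x z : F) : traceForm A n (x ^ (n + 1) * z) ∈
    Submodule.span (Gamma A F (n + 1))
      (Set.range fun j : Fin (n + 1) => traceForm A n (x ^ (j : ℕ) * z)) := by
  obtain ⟨e, h, h0, h1, h2⟩ := exists_hook (A := A) n x
  set M := Submodule.span (Gamma A F (n + 1))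
    (Set.range fun j : Fin (n + 1) => traceForm A n (x ^ (j : ℕ) * z))
  have hmem (j : ℕ) (hj : j ≤ n) : traceForm A n (x ^ j * z) ∈ M :=
    Submodule.subset_span ⟨⟨j, Nat.lt_succ_of_le hj⟩, rfl⟩
  -- Modulo `M`, the form equals `(-1)ⁱ h i (xⁿ⁺¹⁻ⁱ z ·)`; each step trades `h i` for `h (i + 1)`.
  -- At `i = n` the last relation shows that this lies in `M`.
  have key : ∀ i ≤ n, traceForm A n (x ^ (n + 1) * z) -
      (-1 : Gamma A F (n + 1)) ^ i • (fun z' => h i (x ^ (n + 1 - i) * z * z')) ∈ M := by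
    intro i hi
    induction i with
    | zero =>
      simp only [h0, pow_zero, one_smul, Nat.sub_zero]
      exact (sub_self (traceForm A n (x ^ (n + 1) * z))).symm ▸ M.zero_mem
    | succ i ih =>
      have h3 : (fun z' => h (i + 1) (x ^ (n + 1 - (i + 1)) * z * z')) =
          e (i + 1) • traceForm A n (x ^ (n - i) * z) -
            fun z' => h i (x ^ (n + 1 - i) * z * z') := by
        funext z'
        have h4 : x ^ (n + 1 - i) = x * x ^ (n - i) := by
          rw [← pow_succ', Nat.sub_add_comm (by omega)]
        simp only [Pi.sub_apply, Pi.smul_apply, traceForm, smul_eq_mul, h4, mul_assoc,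
          h1 i (by omega), Nat.add_sub_add_right, add_sub_cancel_left]
      have h5 := M.sub_mem (ih (by omega)) (M.smul_mem ((-1) ^ (i + 1) * e (i + 1))
        (hmem (n - i) (by omega)))
      convert h5 using 1
      have h6 : (-1 : Gamma A F (n + 1)) ^ (i + 1) = -(-1) ^ i := by ring
      rw [h3, smul_sub, h6, neg_smul, neg_smul, neg_mul, neg_smul, mul_smul]
      abel
  have h3 : (fun z' => h n (x ^ (n + 1 - n) * z * z')) = e (n + 1) • traceForm A n (x ^ 0 * z) := by
    funext z'
    simp [traceForm, h2, mul_assoc]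
  have h4 := M.add_mem (key n le_rfl) (M.smul_mem ((-1) ^ n * e (n + 1)) (hmem 0 (Nat.zero_le n)))
  rw [h3, mul_smul, sub_add_cancel] at h4
  exact h4

theorem traceForm_mem_span {r : ℕ} (n : ℕ) (φ : MvPolynomial (Fin r) A →ₐ[A] F)
    (hφ : Function.Surjective φ) (w : F) : traceForm A n w ∈ Submodule.span (Gamma A F (n + 1))
      (Set.range fun b : Fin r → Fin (n + 1) =>
        traceForm A n (∏ i, φ (MvPolynomial.X i) ^ (b i : ℕ))) := by
  set M := Submodule.span (Gamma A F (n + 1)) (Set.range fun b : Fin r → Fin (n + 1) =>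
    traceForm A n (∏ i, φ (MvPolynomial.X i) ^ (b i : ℕ)))
  -- Induction on the total degree: an exponent above `n` is lowered by replacing a factor `xᵢⁿ⁺¹`
  -- by powers `xᵢʲ` with `j ≤ n`.
  have hmon : ∀ (d : ℕ) (b : Fin r → ℕ), ∑ i, b i = d →
      traceForm A n (∏ i, φ (MvPolynomial.X i) ^ b i) ∈ M := by
    intro d
    induction d using Nat.strong_induction_on with
    | _ d ih =>
    rintro b rfl
    by_cases hb : ∀ i, b i < n + 1
    · exact Submodule.subset_span ⟨fun i => ⟨b i, hb i⟩, rfl⟩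
    · push Not at hb
      obtain ⟨i, hi⟩ := hb
      have hprod (k : ℕ) : ∏ j, φ (MvPolynomial.X j) ^ Function.update b i k j =
          φ (MvPolynomial.X i) ^ k * ∏ j ∈ univ.erase i, φ (MvPolynomial.X j) ^ b j := by
        rw [← Finset.mul_prod_erase univ _ (mem_univ i), Function.update_self]
        congr 1
        exact Finset.prod_congr rfl fun j hj => by
          rw [Function.update_of_ne (Finset.ne_of_mem_erase hj)]
      have h1 := hprod (b i)
      rw [Function.update_eq_self, ← Nat.add_sub_cancel' hi, pow_add, mul_assoc] at h1
      rw [h1]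
      refine Submodule.span_le.mpr ?_ (traceForm_pow_mul_mem n _ _)
      rintro _ ⟨j, rfl⟩
      have h2 := hprod (j + (b i - (n + 1)))
      rw [pow_add, mul_assoc] at h2
      simp only [← h2]
      refine ih _ ?_ _ rfl
      refine Finset.sum_lt_sum (fun k _ => ?_) ⟨i, mem_univ i, ?_⟩
      · rcases eq_or_ne k i with rfl | hk
        · simp; omega
        · simp [hk]
      · simp; omega
  obtain ⟨p, rfl⟩ := hφ w
  induction p using MvPolynomial.induction_on' with
  | monomial b c =>
    rw [MvPolynomial.monomial_eq, ← MvPolynomial.smul_eq_C_mul, map_smul, ← traceFormLinear_apply,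
      map_smul, ← algebraMap_smul (Gamma A F (n + 1)), Finsupp.prod_fintype _ _ (by simp), map_prod]
    refine M.smul_mem _ ?_
    simpa [traceFormLinear_apply] using hmon _ b rfl
  | add p q hp hq =>
    rw [map_add, ← traceFormLinear_apply, map_add]
    exact M.add_mem hp hq

theorem _root_.MultilinearMap.apply_mem_of_mem_span {R M N ι : Type*} [CommRing R] [AddCommGroup M]
    [Module R M] [AddCommGroup N] [Module R N] [Fintype ι] (f : MultilinearMap R (fun _ : ι => M) N)
    (S : Set M) (J : Submodule R N) (hJ : ∀ v : ι → M, (∀ i, v i ∈ S) → f v ∈ J) (v : ι → M)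
    (hv : ∀ i, v i ∈ Submodule.span R S) : f v ∈ J := by
  classical
  -- The slots in `s` are allowed to lie in the span, the others in `S`; the set `s` grows one slot
  -- at a time.
  suffices h : ∀ (s : Finset ι) (v : ι → M), (∀ i ∈ s, v i ∈ Submodule.span R S) →
      (∀ i ∉ s, v i ∈ S) → f v ∈ J from h univ v (fun i _ => hv i) (by simp)
  intro s
  induction s using Finset.induction_on with
  | empty => exact fun v _ h => hJ v fun i => h i (by simp)
  | insert a s ha ih =>
    intro v h1 h2
    have h3 : ∀ w ∈ Submodule.span R S, f (Function.update v a w) ∈ J := by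
      intro w hw
      induction hw using Submodule.span_induction with
      | mem w hw =>
        refine ih _ (fun i hi => ?_) fun i hi => ?_
        · rw [Function.update_of_ne (fun h : i = a => ha (h ▸ hi))]
          exact h1 i (mem_insert_of_mem hi)
        · rcases eq_or_ne i a with rfl | hia
          · rwa [Function.update_self]
          · rw [Function.update_of_ne hia]
            exact h2 i (by simp [hia, hi])
      | zero => rw [f.map_update_zero]; exact J.zero_mem
      | add w w' _ _ hw hw' => rw [f.map_update_add]; exact J.add_mem hw hw'
      | smul r w _ hw => rw [f.map_update_smul]; exact J.smul_mem r hw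
    simpa using h3 (v a) (h1 a (mem_insert_self a s))

theorem delta_comm (n : ℕ) (x y : Fin (n + 1) → F) : delta (A := A) x y = delta y x := by
  rw [delta_eq_det_trace, delta_eq_det_trace, ← Matrix.det_transpose]
  congr 1
  ext i j
  simp [mul_comm]

/-- For fixed `y`, the element `δ(x, y)` depends on `x` only through the forms `Tr(xᵢ ·)`, and does
so `Γ`-multilinearly. Spanning of forms over `Γ` is therefore enough, although the `S` need not span
`F`. -/
theorem delta_mem_of_mem_span (n : ℕ) (S : Set F)
    (hS : ∀ w : F, traceForm A n w ∈ Submodule.span (Gamma A F (n + 1)) (traceForm A n '' S))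
    (x y : Fin (n + 1) → F) (J : Ideal (Gamma A F (n + 1)))
    (hJ : ∀ x' : Fin (n + 1) → F, (∀ i, x' i ∈ S) → delta x' y ∈ J) : delta x y ∈ J := by
  let f : MultilinearMap (Gamma A F (n + 1)) (fun _ : Fin (n + 1) => F → Gamma A F (n + 1))
      (Gamma A F (n + 1)) :=
    (Matrix.detRowAlternating (n := Fin (n + 1))).toMultilinearMap.compLinearMap
      fun _ => LinearMap.funLeft _ _ y
  have hf (v : Fin (n + 1) → F) : delta (A := A) v y = f fun i => traceForm A n (v i) := by
    rw [delta_eq_det_trace]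
    rfl
  rw [hf]
  refine f.apply_mem_of_mem_span (traceForm A n '' S) J (fun v hv => ?_) _ fun i => hS (x i)
  choose v' hv' hv'' using hv
  obtain rfl : (fun i => traceForm A n (v' i)) = v := funext hv''
  rw [← hf]
  exact hJ v' hv'

theorem normIdeal_top_fg [Algebra.FiniteType A F] (n : ℕ) :
    (normIdeal (n + 1) (⊤ : Submodule A F)).FG := by
  obtain ⟨r, φ, hφ⟩ := Algebra.FiniteType.iff_quotient_mvPolynomial''.mp ‹Algebra.FiniteType A F›
  let b : (Fin r → Fin (n + 1)) → F := fun b => ∏ i, φ (MvPolynomial.X i) ^ (b i : ℕ)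
  have hS : ∀ w : F, traceForm A n w ∈
      Submodule.span (Gamma A F (n + 1)) (traceForm A n '' Set.range b) := by
    intro w
    rw [← Set.range_comp]
    exact traceForm_mem_span n φ hφ w
  let g : (Fin (n + 1) → Fin r → Fin (n + 1)) × (Fin (n + 1) → Fin r → Fin (n + 1)) →
      Gamma A F (n + 1) := fun p => delta (fun i => b (p.1 i)) fun i => b (p.2 i)
  have h : normIdeal (n + 1) (⊤ : Submodule A F) = Ideal.span (Set.range g) := by
    refine le_antisymm (Ideal.span_le.mpr ?_) (Ideal.span_mono ?_)
    · rintro _ ⟨x, y, -, -, rfl⟩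
      refine delta_mem_of_mem_span n _ hS x y _ fun x' hx' => ?_
      rw [delta_comm]
      refine delta_mem_of_mem_span n _ hS y x' _ fun y' hy' => ?_
      choose p hp using hx'
      choose q hq using hy'
      obtain rfl : (fun i => b (p i)) = x' := funext hp
      obtain rfl : (fun i => b (q i)) = y' := funext hq
      exact Ideal.subset_span ⟨(q, p), rfl⟩
    · rintro _ ⟨p, rfl⟩
      exact ⟨_, _, fun _ => trivial, fun _ => trivial, rfl⟩
  rw [h]
  exact ⟨(Set.finite_range g).toFinset, by simp⟩

end

/-! ### Cramer's rule and the exchange identity -/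

section
open Finset

variable {A F : Type u} [CommRing A] [CommRing F] [Algebra A F]

/-- The cofactor in the expansion of `delta x y` along the row of `x j`. -/
noncomputable def deltaCofactor (A : Type u) {F : Type u} [CommRing A] [CommRing F] [Algebra A F]
    {n : ℕ} (x y : Fin (n + 1) → F) (j k : Fin (n + 1)) : Gamma A F (n + 1) :=
  (-1) ^ (j + k : ℕ) *
    (Matrix.of fun i l : Fin n => trace A n (x (j.succAbove i) * y (k.succAbove l))).det

theorem delta_update {n : ℕ} (x y : Fin (n + 1) → F) (j : Fin (n + 1)) (f : F) :
    delta (Function.update x j f) y = ∑ k, trace A n (f * y k) * deltaCofactor A x y j k := by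
  rw [delta_eq_det_trace, Matrix.det_succ_row _ j]
  refine Finset.sum_congr rfl fun k _ => ?_
  rw [deltaCofactor, mul_left_comm, mul_assoc]
  simp only [Matrix.of_apply, Function.update_self]
  congr 3
  ext i l
  simp

theorem delta_update_of_ne {n : ℕ} (x y : Fin (n + 1) → F) {i j : Fin (n + 1)} (h : i ≠ j) :
    delta (A := A) (Function.update x j (x i)) y = 0 := by
  rw [delta_eq_det_trace]
  refine Matrix.det_zero_of_row_eq h ?_
  ext k
  simp [h]

/-- Deleting `x k` from the rows `f, x 0, …, x n` leaves `f` in row zero; moving it to row `k` costs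
the sign `(-1)ᵏ`. -/
theorem det_trace_cons {n : ℕ} (x y : Fin (n + 1) → F) (k : Fin (n + 1)) (f : F) :
    (Matrix.of fun i j : Fin (n + 1) =>
      trace A n (Fin.cons (α := fun _ => F) f x (k.succ.succAbove i) * y j)).det =
      (-1) ^ (k : ℕ) * delta (Function.update x k f) y := by
  rw [delta_update, Matrix.det_succ_row_zero, mul_sum]
  refine Finset.sum_congr rfl fun j _ => ?_
  simp only [Matrix.of_apply, Fin.succ_succAbove_zero, Fin.cons_zero, deltaCofactor]
  have h : ((Matrix.of fun i j : Fin (n + 1) =>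
      trace A n (Fin.cons (α := fun _ => F) f x (k.succ.succAbove i) * y j)).submatrix Fin.succ
        j.succAbove) = Matrix.of fun i l : Fin n =>
          trace A n (x (k.succAbove i) * y (j.succAbove l)) := by
    ext i l
    simp [Fin.succ_succAbove_succ]
  rw [h, pow_add]
  have h2 : ((-1 : Gamma A F (n + 1)) ^ (k : ℕ)) * (-1) ^ (k : ℕ) = 1 := by
    rw [← mul_pow]; simp
  linear_combination (-((-1) ^ (j : ℕ) * trace A n (f * y j) * (Matrix.of fun i l : Fin n =>
          trace A n (x (k.succAbove i) * y (j.succAbove l))).det)) * h2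

/-- Cramer's rule: the vanishing determinant of size `n + 2` with rows `f, x` and columns `z, y`,
expanded along the column of `z`. -/
theorem delta_mul_trace {n : ℕ} (x y : Fin (n + 1) → F) (f z : F) :
    delta x y * trace A n (f * z) =
      ∑ i, delta (Function.update x i f) y * trace A n (x i * z) := by
  have h := det_trace_eq_zero (A := A) n (Fin.cons (α := fun _ => F) f x)
    (Fin.cons (α := fun _ => F) z y)
  rw [Matrix.det_succ_column_zero, Fin.sum_univ_succ] at h
  have h0 : ((Matrix.of fun i j : Fin (n + 2) => trace A n
      (Fin.cons (α := fun _ => F) f x i * Fin.cons (α := fun _ => F) z y j)).submatrix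
        (Fin.succAbove 0) Fin.succ).det = delta x y := by
    rw [delta_eq_det_trace]
    congr 1
  have h1 (k : Fin (n + 1)) : ((Matrix.of fun i j : Fin (n + 2) => trace A n
      (Fin.cons (α := fun _ => F) f x i * Fin.cons (α := fun _ => F) z y j)).submatrix
        k.succ.succAbove Fin.succ).det = (-1) ^ (k : ℕ) * delta (Function.update x k f) y :=
    det_trace_cons x y k f
  simp only [h0, h1, Matrix.of_apply, Fin.cons_zero, Fin.cons_succ, Fin.val_zero, pow_zero,
    one_mul, Fin.val_succ] at h
  rw [mul_comm, eq_neg_of_add_eq_zero_left h, ← Finset.sum_neg_distrib]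
  refine Finset.sum_congr rfl fun k _ => ?_
  have h2 : ((-1 : Gamma A F (n + 1)) ^ (k : ℕ)) * (-1) ^ (k : ℕ) = 1 := by
    rw [← mul_pow]; simp
  linear_combination (trace A n (x k * z) * delta (Function.update x k f) y) * h2

/-- Expansion of the second factor along row `j` reduces this to `delta_mul_trace` with `z = g * y
k`. If `δ(x, y)` is invertible, it expresses the coordinates of `g * f` through those of `f`. -/
theorem delta_exchange {n : ℕ} (x y : Fin (n + 1) → F) (j : Fin (n + 1)) (f g : F) :
    delta (A := A) x y * delta (Function.update x j (g * f)) y =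
      ∑ i, delta (Function.update x i f) y * delta (Function.update x j (g * x i)) y := by
  simp only [delta_update x y j, mul_sum]
  rw [Finset.sum_comm]
  refine Finset.sum_congr rfl fun k _ => ?_
  rw [← mul_assoc, mul_comm g f, mul_assoc f, delta_mul_trace, sum_mul]
  refine Finset.sum_congr rfl fun i _ => ?_
  rw [mul_assoc, mul_left_comm (x i), mul_assoc g]

end

/-! ### The elements δ in degree one of the Rees algebra -/

section
open Polynomial

variable {A F : Type u} [CommRing A] [CommRing F] [Algebra A F]

theorem delta_mem_normIdeal {n : ℕ} {V : Submodule A F} {x y : Fin n → F} (hx : ∀ i, x i ∈ V)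
    (hy : ∀ i, y i ∈ V) : delta x y ∈ normIdeal n V :=
  Ideal.subset_span ⟨x, y, hx, hy, rfl⟩

/-- An element `r ∈ I` in degree one of the Rees algebra. -/
noncomputable def reesOne {R : Type u} [CommRing R] (I : Ideal R) : I →ₗ[R] reesAlgebra I :=
  LinearMap.codRestrict (Subalgebra.toSubmodule (reesAlgebra I))
    (monomial 1 ∘ₗ I.subtype) fun r => reesAlgebra.monomial_mem.mpr (by simp)

theorem coe_reesOne {R : Type u} [CommRing R] (I : Ideal R) (r : I) :
    (reesOne I r : R[X]) = monomial 1 (r : R) := rfl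

variable (A) in
/-- The element `δ(x, y) t` of the Rees algebra of `I_F`. -/
noncomputable def deltaRees {n : ℕ} (x y : Fin n → F) :
    reesAlgebra (normIdeal n (⊤ : Submodule A F)) :=
  reesOne _ ⟨delta x y, delta_mem_normIdeal (fun _ => trivial) fun _ => trivial⟩

theorem coe_deltaRees {n : ℕ} (x y : Fin n → F) :
    (deltaRees A x y : (Gamma A F n)[X]) = monomial 1 (delta x y) := rfl

theorem deltaRees_exchange {n : ℕ} (x y : Fin (n + 1) → F) (j : Fin (n + 1)) (f g : F) :
    deltaRees A x y * deltaRees A (Function.update x j (g * f)) y =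
      ∑ i, deltaRees A (Function.update x i f) y *
        deltaRees A (Function.update x j (g * x i)) y := by
  refine Subtype.ext ?_
  simp only [MulMemClass.coe_mul, AddSubmonoidClass.coe_finsetSum, coe_deltaRees,
    monomial_mul_monomial, delta_exchange, map_sum]

theorem deltaRees_comm {n : ℕ} (x y : Fin (n + 1) → F) : deltaRees A x y = deltaRees A y x :=
  Subtype.ext (by rw [coe_deltaRees, coe_deltaRees, delta_comm])

theorem deltaRees_update_add {n : ℕ} (x y : Fin (n + 1) → F) (j : Fin (n + 1)) (f g : F) :
    deltaRees A (Function.update x j (f + g)) y =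
      deltaRees A (Function.update x j f) y + deltaRees A (Function.update x j g) y := by
  refine Subtype.ext ?_
  rw [AddMemClass.coe_add, coe_deltaRees, coe_deltaRees, coe_deltaRees, ← map_add]
  simp only [delta_update, ← Finset.sum_add_distrib, add_mul f g, ← traceLinear_apply, map_add,
    add_mul (traceLinear A F n _)]

theorem deltaRees_update_smul {n : ℕ} (x y : Fin (n + 1) → F) (j : Fin (n + 1)) (r : A) (f : F) :
    deltaRees A (Function.update x j (r • f)) y =
      algebraMap (Gamma A F (n + 1)) _ (algebraMap A _ r) *
        deltaRees A (Function.update x j f) y := by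
  refine Subtype.ext ?_
  rw [← Algebra.smul_def, Subalgebra.coe_smul, coe_deltaRees, coe_deltaRees, ← map_smul]
  simp only [delta_update, Finset.smul_sum, smul_eq_mul, ← Algebra.smul_def, smul_mul_assoc,
    ← traceLinear_apply, map_smul]

theorem deltaRees_update_of_ne {n : ℕ} (x y : Fin (n + 1) → F) {i j : Fin (n + 1)} (h : i ≠ j) :
    deltaRees A (Function.update x j (x i)) y = 0 :=
  Subtype.ext (by rw [coe_deltaRees, delta_update_of_ne x y h, map_zero]; rfl)

end

/-! ### From points of the Rees algebra to quotients of rank n + 1 -/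

section
open TensorProduct

theorem isHilbPoint_of_equiv {A F : Type u} [CommRing A] [CommRing F] [Algebra A F] {K : Type u}
    [Field K] [Algebra A K] {n : ℕ} (I : Ideal (K ⊗[A] F)) (e : ((K ⊗[A] F) ⧸ I) ≃ₗ[K] (Fin n → K)) :
    IsHilbPoint n I := by
  have h : Module.Finite K ((K ⊗[A] F) ⧸ I) := Module.Finite.equiv e.symm
  refine ⟨h, inferInstance, fun p => ?_⟩
  rw [Module.rankAtStalk_eq_finrank_of_free]
  simp [e.finrank_eq]

variable {A F : Type u} [CommRing A] [CommRing F] [Algebra A F]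

/-- The Cramer coordinates relative to `x` define a quotient algebra of `K ⊗ F` of dimension `n +
1`, a point of the Hilbert functor over `K`. The image of `V` spans it, so the `j`-th coordinate
cannot vanish on all of `V`. -/
theorem exists_mem_deltaRees_ne_zero {n : ℕ} {V : Submodule A F}
    (hV : IsSufficientlyBig (n + 1) V) {K : Type u} [Field K]
    (ψ : reesAlgebra (normIdeal (n + 1) (⊤ : Submodule A F)) →+* K) {x y : Fin (n + 1) → F}
    (hxy : ψ (deltaRees A x y) ≠ 0) (j : Fin (n + 1)) :
    ∃ v ∈ V, ψ (deltaRees A (Function.update x j v) y) ≠ 0 := by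
  algebraize [ψ.comp ((algebraMap (Gamma A F (n + 1)) _).comp (algebraMap A _))]
  have halg (r : A) : algebraMap A K r =
    ψ (algebraMap (Gamma A F (n + 1)) _ (algebraMap A _ r)) := rfl
  let L : F →ₗ[A] Fin (n + 1) → K :=
    { toFun f i := ψ (deltaRees A (Function.update x i f) y)
      map_add' f g := by
        funext i
        simp only [deltaRees_update_add, map_add, Pi.add_apply]
      map_smul' r f := by
        funext i
        rw [deltaRees_update_smul, map_mul, ← halg, ← Algebra.smul_def]
        rfl }
  have hL (f : F) (i : Fin (n + 1)) : L f i = ψ (deltaRees A (Function.update x i f) y) := rfl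
  let Φ : K ⊗[A] F →ₗ[K] Fin (n + 1) → K := L.liftBaseChange K
  have hΦ (k : K) (f : F) (i : Fin (n + 1)) :
      Φ (k ⊗ₜ f) i = k * ψ (deltaRees A (Function.update x i f) y) := by
    simp [Φ, hL]
  -- By the exchange identity, multiplication by `g` acts through the coordinates of `z` alone, so
  -- the kernel of `Φ` is an ideal.
  have hmul (k : K) (g : F) (z : K ⊗[A] F) (i : Fin (n + 1)) :
      ψ (deltaRees A x y) * Φ (k ⊗ₜ g * z) i =
        k * ∑ l, Φ z l * ψ (deltaRees A (Function.update x i (g * x l)) y) := by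
    induction z using TensorProduct.induction_on with
    | zero => simp
    | tmul k' f =>
      simp only [Algebra.TensorProduct.tmul_mul_tmul, hΦ]
      rw [mul_left_comm, ← map_mul, deltaRees_exchange, map_sum, mul_assoc, Finset.mul_sum]
      simp only [map_mul, mul_assoc]
    | add z w hz hw =>
      simp only [mul_add, map_add, Pi.add_apply, hz, hw, add_mul, Finset.sum_add_distrib]
  let I : Ideal (K ⊗[A] F) :=
    { carrier := {z | Φ z = 0}
      add_mem' := fun {z w} hz hw => by
        simp only [Set.mem_ofPred_eq] at hz hw ⊢
        rw [map_add, hz, hw, add_zero]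
      zero_mem' := map_zero Φ
      smul_mem' := fun c z hz => by
        simp only [Set.mem_ofPred_eq, smul_eq_mul] at hz ⊢
        induction c using TensorProduct.induction_on with
        | zero => simp
        | tmul k g =>
          funext i
          refine (mul_eq_zero.mp ((hmul k g z i).trans ?_)).resolve_left hxy
          simp [hz]
        | add c d hc hd => rw [add_mul, map_add, hc, hd, add_zero] }
  have hI (z : K ⊗[A] F) : z ∈ I ↔ Φ z = 0 := Iff.rfl
  -- The images of the `x i` are a nonzero multiple of the standard basis: replacing `x l` by `x i`
  -- with `i ≠ l` repeats a row.
  have hbasis (i : Fin (n + 1)) :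
      Φ (1 ⊗ₜ x i) = Pi.single i (ψ (deltaRees A x y)) := by
    funext l
    rw [hΦ, one_mul]
    rcases eq_or_ne i l with rfl | h
    · simp
    · rw [deltaRees_update_of_ne x y h, map_zero, Pi.single_eq_of_ne h.symm]
  have hsurj : Function.Surjective Φ := by
    intro v
    refine ⟨∑ i, (v i * (ψ (deltaRees A x y))⁻¹) • (1 ⊗ₜ x i), ?_⟩
    simp only [map_sum, map_smul, hbasis]
    funext l
    simp [Finset.sum_apply, Pi.single_apply, hxy]
  let q : K ⊗[A] F →ₗ[K] (K ⊗[A] F) ⧸ I := (Ideal.Quotient.mkₐ K I).toLinearMap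
  have hq : Function.Surjective q := Ideal.Quotient.mkₐ_surjective K I
  have hker : LinearMap.ker q = LinearMap.ker Φ := by
    ext z
    rw [LinearMap.mem_ker, LinearMap.mem_ker, ← hI, ← Ideal.Quotient.eq_zero_iff_mem]
    rfl
  obtain ⟨t, ht⟩ := hV K I (isHilbPoint_of_equiv I ((q.quotKerEquivOfSurjective hq).symm.trans
    ((Submodule.quotEquivOfEq _ _ hker).trans (Φ.quotKerEquivOfSurjective hsurj))))
    (q (1 ⊗ₜ x j))
  have ht' : Φ (V.subtype.baseChange K t) = Φ (1 ⊗ₜ x j) := by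
    rw [← sub_eq_zero, ← map_sub, ← LinearMap.mem_ker, ← hker, LinearMap.mem_ker, map_sub,
      sub_eq_zero]
    exact ht
  -- Otherwise the `j`-th coordinate vanishes on the image of `K ⊗ V`, which contains the image of
  -- `x j`, whose `j`-th coordinate is `ψ (δ(x, y) t)`.
  by_contra! h
  refine hxy ?_
  have hj := congrFun ht' j
  rw [hbasis, Pi.single_eq_same] at hj
  rw [← hj]
  clear hj ht' ht
  induction t using TensorProduct.induction_on with
  | zero => simp
  | tmul k v => simp [hΦ, h v.1 v.2]
  | add s t hs ht => rw [map_add, map_add, Pi.add_apply, hs, ht, add_zero]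

theorem exists_forall_mem_deltaRees_ne_zero {n : ℕ} {V : Submodule A F}
    (hV : IsSufficientlyBig (n + 1) V) {K : Type u} [Field K]
    (ψ : reesAlgebra (normIdeal (n + 1) (⊤ : Submodule A F)) →+* K) {x y : Fin (n + 1) → F}
    (hxy : ψ (deltaRees A x y) ≠ 0) :
    ∃ v : Fin (n + 1) → F, (∀ i, v i ∈ V) ∧ ψ (deltaRees A v y) ≠ 0 := by
  suffices h : ∀ s : Finset (Fin (n + 1)), ∃ v : Fin (n + 1) → F,
      (∀ i ∈ s, v i ∈ V) ∧ ψ (deltaRees A v y) ≠ 0 by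
    obtain ⟨v, hv, h⟩ := h Finset.univ
    exact ⟨v, fun i => hv i (Finset.mem_univ i), h⟩
  intro s
  induction s using Finset.induction_on with
  | empty => exact ⟨x, by simp, hxy⟩
  | insert a s _ ih =>
    obtain ⟨v, hv, h⟩ := ih
    obtain ⟨w, hw, h'⟩ := exists_mem_deltaRees_ne_zero hV ψ h a
    refine ⟨_, fun i hi => ?_, h'⟩
    rcases eq_or_ne i a with rfl | hia
    · rwa [Function.update_self]
    · rw [Function.update_of_ne hia]
      exact hv i (Finset.mem_of_mem_insert_of_ne hi hia)

end

/-! ### The Rees algebra in degrees zero and one, and the covering of the source -/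

section
open Polynomial AlgebraicGeometry

variable {R : Type u} [CommRing R]

theorem coe_mem_reesGrading_zero {I : Ideal R} (r : R) :
    algebraMap R (reesAlgebra I) r ∈ reesGrading I 0 := ⟨r, rfl⟩

theorem mem_reesGrading_zero {I : Ideal R} {f : reesAlgebra I} (hf : f ∈ reesGrading I 0) :
    ∃ r, algebraMap R (reesAlgebra I) r = f := by
  obtain ⟨r, hr⟩ := hf
  exact ⟨r, Subtype.ext hr⟩

/-- Generators of the Rees algebra over `R` also generate it over its degree zero part, through
which the structure map factors. -/
theorem finiteType_reesGrading_zero {I : Ideal R} (hI : I.FG) :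
    Algebra.FiniteType (reesGrading I 0) (reesAlgebra I) := by
  have : Algebra.FiniteType R (reesAlgebra I) :=
    (Subalgebra.fg_iff_finiteType _).mp (reesAlgebra.fg hI)
  let f : R →+* reesGrading I 0 :=
    { toFun r := ⟨algebraMap R (reesAlgebra I) r, coe_mem_reesGrading_zero r⟩
      map_one' := Subtype.ext (map_one _)
      map_mul' r s := Subtype.ext (map_mul _ r s)
      map_zero' := Subtype.ext (map_zero _)
      map_add' r s := Subtype.ext (map_add _ r s) }
  refine RingHom.finiteType_algebraMap.mp (RingHom.FiniteType.of_comp_finiteType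
    (A := R) (B := reesGrading I 0) (C := reesAlgebra I) (f := f) ?_)
  exact RingHom.finiteType_algebraMap.mpr this

theorem monomial_mem_of_reesOne_mem {I : Ideal R} (P : Ideal (reesAlgebra I))
    (h : ∀ r, reesOne I r ∈ P) {m : ℕ} (hm : 0 < m) {f : reesAlgebra I}
    (hf : f ∈ reesGrading I m) : f ∈ P := by
  obtain ⟨k, rfl⟩ := Nat.exists_eq_succ_of_ne_zero hm.ne'
  obtain ⟨r, hr⟩ := mem_reesGrading.mp hf
  have hr' : r ∈ I ^ (k + 1) := by
    rw [← reesAlgebra.monomial_mem, hr]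
    exact f.2
  -- The power is split as `I ^ k * I`, so that each product `a * b` gives `a tᵏ` times an element
  -- `b t` of degree one.
  suffices H : ∀ r (hr : r ∈ I ^ k * I), (⟨monomial (k + 1) r,
      reesAlgebra.monomial_mem.mpr ((pow_succ I k).symm ▸ hr)⟩ : reesAlgebra I) ∈ P by
    convert H r ((pow_succ I k) ▸ hr') using 1
    exact Subtype.ext hr.symm
  intro r hr
  induction hr using Submodule.mul_induction_on' with
  | mem_mul_mem a ha b hb =>
    convert P.mul_mem_left ⟨monomial k a, reesAlgebra.monomial_mem.mpr ha⟩ (h ⟨b, hb⟩) using 1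
    refine Subtype.ext ?_
    simp [coe_reesOne, monomial_mul_monomial]
  | add a _ b _ ha hb =>
    convert P.add_mem ha hb using 1
    refine Subtype.ext ?_
    simp

variable {A F : Type u} [CommRing A] [CommRing F] [Algebra A F]

/-- The `r` in `I_F` with `r t` in `p` form an ideal. If it contained all `δ(x, y)`, it would be
`I_F`, and `p` would contain the irrelevant ideal. -/
theorem exists_deltaRees_notMem {n : ℕ}
    (p : Proj (reesGrading (normIdeal n (⊤ : Submodule A F)))) :
    ∃ x y : Fin n → F, deltaRees A x y ∉ p.asHomogeneousIdeal.toIdeal := by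
  by_contra! h
  refine p.not_irrelevant_le ((HomogeneousIdeal.irrelevant_le _).mpr fun m hm f hf => ?_)
  refine monomial_mem_of_reesOne_mem _ ?_ hm hf
  rintro ⟨r, hr⟩
  have h1 : normIdeal n (⊤ : Submodule A F) ≤
      ((p.asHomogeneousIdeal.toIdeal.restrictScalars (Gamma A F n)).comap
        (reesOne (normIdeal n (⊤ : Submodule A F)))).map (Submodule.subtype _) := by
    refine Ideal.span_le.mpr ?_
    rintro _ ⟨x, y, -, -, rfl⟩
    exact ⟨⟨delta x y, delta_mem_normIdeal (fun _ => trivial) fun _ => trivial⟩, h x y, rfl⟩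
  obtain ⟨r', hr', rfl⟩ := h1 hr
  exact hr'

theorem exists_ringHom_field (P : Ideal R) [P.IsPrime] :
    ∃ (K : Type u) (_ : Field K) (ψ : R →+* K), ∀ a, ψ a = 0 ↔ a ∈ P :=
  ⟨P.ResidueField, inferInstance, algebraMap R _, fun _ =>
    Ideal.algebraMap_residueField_eq_zero⟩

theorem exists_notMem_of_isSufficientlyBig {n : ℕ} {V : Submodule A F}
    (hV : IsSufficientlyBig (n + 1) V)
    (p : Proj (reesGrading (normIdeal (n + 1) (⊤ : Submodule A F)))) :
    ∃ m : ℕ, 0 < m ∧ ∃ a ∈ reesGrading (normIdeal (n + 1) V) m,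
      reesInclusion (normIdeal_mono (n + 1) (le_top : V ≤ ⊤)) a ∉ p.asHomogeneousIdeal := by
  let P : Ideal (reesAlgebra (normIdeal (n + 1) (⊤ : Submodule A F))) :=
    p.asHomogeneousIdeal.toIdeal
  have hP : P.IsPrime := p.isPrime
  obtain ⟨K, _, ψ, hψ⟩ := exists_ringHom_field P
  obtain ⟨x, y, hxy⟩ := exists_deltaRees_notMem p
  obtain ⟨v, hv, h1⟩ := exists_forall_mem_deltaRees_ne_zero hV ψ (mt (hψ _).mp hxy)
  -- The symmetry of `δ` turns the second argument into the first, so that the same replacement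
  -- applies to `y`.
  rw [deltaRees_comm] at h1
  obtain ⟨w, hw, h2⟩ := exists_forall_mem_deltaRees_ne_zero hV ψ h1
  refine ⟨1, one_pos, reesOne _ ⟨delta w v, delta_mem_normIdeal hw hv⟩, ⟨_, rfl⟩, ?_⟩
  exact mt (hψ _).mpr h2

end

end NormBlowup

theorem mainTheorem10 {A F : Type u} [CommRing A] [IsNoetherianRing A] [CommRing F] [Algebra A F]
    [Algebra.FiniteType A F] (n : ℕ) (hn : 0 < n) (V : Submodule A F)
    (hV : NormBlowup.IsSufficientlyBig n V) :
    -- no point of the source lies over the locus where the induced morphism is undefined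
    (∀ p : AlgebraicGeometry.Proj (NormBlowup.reesGrading (NormBlowup.normIdeal n (⊤ : Submodule A F))),
      ∃ m : ℕ, 0 < m ∧ ∃ a ∈ NormBlowup.reesGrading (NormBlowup.normIdeal n V) m,
        NormBlowup.reesInclusion (NormBlowup.normIdeal_mono n (le_top : V ≤ ⊤)) a ∉
          p.asHomogeneousIdeal) ∧
    (∃! φ : AlgebraicGeometry.Proj
          (NormBlowup.reesGrading (NormBlowup.normIdeal n (⊤ : Submodule A F))) ⟶
        AlgebraicGeometry.Proj (NormBlowup.reesGrading (NormBlowup.normIdeal n V)),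
      NormBlowup.IsInducedOnProj
        (NormBlowup.reesInclusion (NormBlowup.normIdeal_mono n (le_top : V ≤ ⊤))) φ) ∧
    ∀ φ : AlgebraicGeometry.Proj
          (NormBlowup.reesGrading (NormBlowup.normIdeal n (⊤ : Submodule A F))) ⟶
        AlgebraicGeometry.Proj (NormBlowup.reesGrading (NormBlowup.normIdeal n V)),
      NormBlowup.IsInducedOnProj
        (NormBlowup.reesInclusion (NormBlowup.normIdeal_mono n (le_top : V ≤ ⊤))) φ →
      AlgebraicGeometry.IsFinite φ := by
  -- The trace `γ¹(u) * γⁿ(1)` has degree `n + 1`, hence the shift; this is where a positive degree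
  -- is needed.
  obtain ⟨n, rfl⟩ := Nat.exists_eq_succ_of_ne_zero hn.ne'
  have h := NormBlowup.exists_notMem_of_isSufficientlyBig hV
  refine ⟨h, ?_, fun φ hφ => ?_⟩
  · obtain ⟨φ, hφ⟩ := NormBlowup.exists_isInducedOnProj h
    exact ⟨φ, hφ, fun ψ hψ => hψ.unique h hφ⟩
  · have := NormBlowup.finiteType_reesGrading_zero (NormBlowup.normIdeal_top_fg (A := A) (F := F) n)
    refine hφ.isFinite h fun y hy => ?_
    obtain ⟨r, rfl⟩ := NormBlowup.mem_reesGrading_zero hy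
    exact ⟨algebraMap _ _ r, NormBlowup.coe_mem_reesGrading_zero r, rfl⟩
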